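/- Let $M$ be a connected (Hausdorff, second countable) smooth $n$-manifold and let $\Gamma$ be a transitive pseudogroup of smooth local diffeomorphisms of $M$, for example a transitive algebraic Lie pseudogroup. For $a,b\in M$ let $G_1(a,b)$ be the set of differentials $d_a\varphi\colon T_aM\to T_bM$ of elements $\varphi\in\Gamma$ with $\varphi(a)=b$, and let $G_1(a)=G_1(a,a)$ be the linear isotropy group. Let $A_1,A_2$ be linear scalar differential operators of order $\le k$ on $C^\infty(M)$, with principal symbols $\sigma_{A_i}$ (symmetric contravariant tensor fields of degree $k$). Assume that, for $i=1,2$: (a) $A_i$ has constant $\Gamma$-type: $L_*(O_a)=O_b$ for all $a,b\in M$ and all $L\in G_1(a,b)$, where $O_a\subset S^kT_aM$ is the $G_1(a)$-orbit of $\sigma_{A_i,a}$; (b) the stabilizer of $\sigma_{A_i,a}$ in $G_1(a)$ is finite for all $a\in M$. Let $\nabla_i$ be the Wagner connection of $A_i$ (which exists and is unique if $\Gamma$ is an algebraic Lie pseudogroup, and is assumed to exist otherwise), i.e. the smooth affine connection whose parallel transports along smooth paths from $a$ to $b$ belong to $G_1(a,b)$ and preserve $\sigma_{A_i}$. For an affine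 connection $\nabla$, let $d^s_\nabla$ be the covariant differential of symmetric covariant tensor fields followed by symmetrization. For a symmetric contravariant tensor field $H$ of degree $j$ put $$Q_\nabla(H)(f)=\frac1{j!}\big\langle H,(d^s_\nabla)^jf\big\rangle ,$$ where the pairing is normalized by $\langle X_1\cdots X_j,\omega\rangle=\sum_{\pi}\omega(X_{\pi(1)},\dots,X_{\pi(j)})$, the sum being over all permutations $\pi$ of $\{1,\dots,j\}$; then $Q_\nabla(H)$ has symbol $H$. The total symbol $[\sigma_k,\dots,\sigma_0]$ of an operator $A$ of order $\le k$ with respect to $\nabla$ is defined by $R_k=A$, $\sigma_j=$ the degree $j$ symbol of $R_j$, and $R_{j-1}=R_j-Q_\nabla(\sigma_j)$, so that $\sigma_k=\sigma_A$ and $A=\sum_{j=0}^kQ_\nabla(\sigma_j)$. Then for all open sets $U,V\subset M$ (in particular for $U=V=M$) the operators $A_1$ and $A_2$ are $\Gamma$-equivalent in $U$ and $V$ if and only if the total symbol of $A_1$ with respect to $\nabla_1$ and the total symbol of $A_2$ with respect to $\nabla_2$ are $\Gamma$-equivalent in $U$ and $V$. Here operators (respectively total symbols) are $\Gamma$-equivalent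 in $U$ and $V$ if some diffeomorphism $\varphi\colon U\to V$ in $\Gamma$ carries the restriction of the first to $U$ to the restriction of the second to $V$; for total symbols this means that $\varphi$ carries every component $\sigma_j$, $0\le j\le k$. -/

import Mathlib

open Set Filter
open scoped Manifold ContDiff Topology

noncomputable section

namespace GammaOp

/-! ### Functions, vector fields and affine connections on a manifold -/

section Basic

variable (n : ℕ) (M : Type*) [TopologicalSpace M] [ChartedSpace (EuclideanSpace ℝ (Fin n)) M]

/-- The algebra `C^∞(M)`. -/
abbrev Smooth := C^∞⟮𝓡 n, M; ℝ⟯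

variable [IsManifold (𝓡 n) ∞ M]

/-- The smooth vector fields on `M`. -/
abbrev VF := Cₛ^∞⟮𝓡 n; EuclideanSpace ℝ (Fin n), (TangentSpace (𝓡 n) : M → Type)⟯

/-- Affine connections on `M` as Koszul connections in the tangent bundle: `nab Y x v` is
`(∇_v Y)(x)`. Smoothness is the separate condition `nab.ContMDiffCovariantDerivative ∞`. -/
abbrev AffineConnection :=
  CovariantDerivative (𝓡 n) (EuclideanSpace ℝ (Fin n)) (TangentSpace (𝓡 n) : M → Type)

end Basic

variable {n : ℕ} {M : Type*} [TopologicalSpace M] [ChartedSpace (EuclideanSpace ℝ (Fin n)) M]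

/-- The cotangent space `T_x^* M`. -/
abbrev Cotangent (x : M) : Type := TangentSpace (𝓡 n) x →L[ℝ] ℝ

/-- Contravariant `k`-tensors at `x`, as `k`-linear forms on the cotangent space. A symmetric one
is an element of `S^k T_x M`; it corresponds to the homogeneous polynomial
`θ ↦ σ (θ, …, θ)` on `T_x^* M`. -/
abbrev ContraTensor (k : ℕ) (x : M) : Type :=
  MultilinearMap ℝ (fun _ : Fin k => Cotangent (n := n) x) ℝ

/-- The action `S^k T_a M → S^k T_b M` of a linear map `L : T_a M → T_b M`. -/
def pushTensor {k : ℕ} {a b : M} (L : TangentSpace (𝓡 n) a →L[ℝ] TangentSpace (𝓡 n) b)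
    (σ : ContraTensor (n := n) k a) : ContraTensor (n := n) k b :=
  σ.compLinearMap fun _ =>
    { toFun := fun θ => θ.comp L
      map_add' := fun _ _ => rfl
      map_smul' := fun _ _ => rfl }

/-! ### Linear differential operators and their symbols -/

/-- `A` is a linear differential operator of order `≤ k` on `C^∞(M)`: all its `(k + 1)`-fold
commutators with multiplications by smooth functions vanish. -/
def IsDiffOp : ℕ → (Smooth n M →ₗ[ℝ] Smooth n M) → Prop
  | 0, A => ∀ f : Smooth n M,
      A ∘ₗ LinearMap.mulLeft ℝ f - LinearMap.mulLeft ℝ f ∘ₗ A = 0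
  | k + 1, A => ∀ f : Smooth n M,
      IsDiffOp k (A ∘ₗ LinearMap.mulLeft ℝ f - LinearMap.mulLeft ℝ f ∘ₗ A)

/-- An operator on smooth functions, regarded as taking values in all functions. -/
def toFunOp (A : Smooth n M →ₗ[ℝ] Smooth n M) : Smooth n M →ₗ[ℝ] (M → ℝ) where
  toFun f := A f
  map_add' f g := by rw [map_add]; rfl
  map_smul' c f := by rw [map_smul]; rfl

section TestFunctions

variable [T2Space M] [IsManifold (𝓡 n) ∞ M]

/-- A smooth bump function centred at `x`, equal to `1` near `x` and supported in the chart
at `x`. -/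
def bump (x : M) : SmoothBumpFunction (𝓡 n) x := Classical.arbitrary _

/-- A smooth function `f` with `f x = 0` and `d_x f = θ`, depending linearly on `θ`: the linear
function `θ` in the chart at `x`, cut off outside a neighbourhood of `x`. -/
def testFn (x : M) : Cotangent (n := n) x →ₗ[ℝ] Smooth n M where
  toFun θ :=
    ⟨fun y => bump (n := n) x y •
        (θ : EuclideanSpace ℝ (Fin n) →L[ℝ] ℝ) (extChartAt (𝓡 n) x y - extChartAt (𝓡 n) x x), by
      apply (bump (n := n) x).contMDiff_smul
      have h : ContMDiffOn (𝓡 n) 𝓘(ℝ, EuclideanSpace ℝ (Fin n)) ∞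
          (fun y => extChartAt (𝓡 n) x y - extChartAt (𝓡 n) x x)
          (chartAt (EuclideanSpace ℝ (Fin n)) x).source :=
        (contMDiffOn_extChartAt (I := 𝓡 n) (n := ∞) (x := x)).sub contMDiffOn_const
      exact (ContinuousLinearMap.contMDiff
        (θ : EuclideanSpace ℝ (Fin n) →L[ℝ] ℝ)).comp_contMDiffOn h⟩
  map_add' θ θ' := by
    ext y
    exact mul_add _ _ _
  map_smul' c θ := by
    ext y
    exact mul_left_comm _ _ _

/-- The symbol of degree `k` of an operator `R` of order `≤ k`:
`σ_x (d_x f_1, …, d_x f_k) = (1 / k!) R (f_1 ⋯ f_k) (x)` for functions `f_i` with `f_i x = 0`.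
For `R = ∑ a_α ∂^α` this is the symmetric tensor with polynomial `∑_{|α| = k} a_α θ^α`. -/
def smbl (k : ℕ) (R : Smooth n M →ₗ[ℝ] (M → ℝ)) (x : M) : ContraTensor (n := n) k x :=
  ((Nat.factorial k : ℝ)⁻¹) •
    (((LinearMap.proj x ∘ₗ R).compMultilinearMap
      (MultilinearMap.mkPiAlgebra ℝ (Fin k) (Smooth n M))).compLinearMap fun _ => testFn x)

end TestFunctions

/-! ### Symmetrised covariant differentials -/

section Connection

variable [IsManifold (𝓡 n) ∞ M]

/-- The function `X f = df(X)`. -/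
def lieFn (X : VF n M) (f : Smooth n M) : Smooth n M :=
  ⟨fun y => mvfderiv (𝓡 n) f y (X y), by
    have h : ContMDiff (𝓡 n).tangent 𝓘(ℝ, ℝ).tangent ∞ (tangentMap (𝓡 n) 𝓘(ℝ, ℝ) f) :=
      f.contMDiff.contMDiff_tangentMap (by simp)
    exact (contMDiff_snd_tangentBundle_modelSpace ℝ 𝓘(ℝ, ℝ)).comp (h.comp X.contMDiff)⟩

/-- The vector field `∇_X Y`. -/
def nabla (nab : AffineConnection n M) [nab.ContMDiffCovariantDerivative ∞] (X Y : VF n M) :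
    VF n M :=
  ⟨fun y => nab Y y (X y), by
    have h := CovariantDerivative.ContMDiffCovariantDerivative.contMDiff (cov := nab) (k := ∞)
    have hY := h.contMDiff (σ := fun y => Y y) Y.contMDiff.contMDiffOn
    exact (contMDiffOn_univ.mp hY).clm_bundle_apply X.contMDiff⟩

variable (n M) in
/-- Covariant `k`-tensor fields, as functions of `k` smooth vector fields with values in
`C^∞(M)`. Only those obtained from functions by covariant differentiation and symmetrisation are
used below; they are `C^∞(M)`-multilinear. -/
abbrev CovField (k : ℕ) := (Fin k → VF n M) → Smooth n M

/-- The covariant differential `d_∇` of covariant tensor fields, for the connection induced by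
`∇` on (tensor powers of) the cotangent bundle:
`(d_∇ η)(X_0, …, X_k) = X_0 (η(X_1, …, X_k)) - ∑_i η(X_1, …, ∇_{X_0} X_i, …, X_k)`. -/
def covDiff (nab : AffineConnection n M) [nab.ContMDiffCovariantDerivative ∞] {k : ℕ}
    (η : CovField n M k) : CovField n M (k + 1) := fun X =>
  lieFn (X 0) (η (Fin.tail X)) -
    ∑ i : Fin k, η (Function.update (Fin.tail X) i (nabla nab (X 0) (Fin.tail X i)))

/-- Symmetrisation of covariant tensor fields. -/
def symmetrize {k : ℕ} (η : CovField n M k) : CovField n M k := fun X =>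
  ((Nat.factorial k : ℝ)⁻¹) • ∑ p : Equiv.Perm (Fin k), η (X ∘ p)

/-- The iterated symmetrised covariant differential `(d_∇^s)^k f`, where `d_∇^s` is `d_∇` followed
by symmetrisation. -/
def symDiffPow (nab : AffineConnection n M) [nab.ContMDiffCovariantDerivative ∞] :
    (k : ℕ) → Smooth n M → CovField n M k
  | 0, f => fun _ => f
  | k + 1, f => symmetrize (covDiff nab (symDiffPow nab k f))

theorem lieFn_add (X : VF n M) (f g : Smooth n M) :
    lieFn X (f + g) = lieFn X f + lieFn X g := by
  ext y
  have hf : MDifferentiableAt (𝓡 n) 𝓘(ℝ, ℝ) f y := f.contMDiff.mdifferentiable (by simp) y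
  have hg : MDifferentiableAt (𝓡 n) 𝓘(ℝ, ℝ) g y := g.contMDiff.mdifferentiable (by simp) y
  have h := mvfderiv_add hf hg
  exact DFunLike.congr_fun h (X y)

theorem lieFn_smul (X : VF n M) (c : ℝ) (f : Smooth n M) :
    lieFn X (c • f) = c • lieFn X f := by
  ext y
  have hf : MDifferentiableAt (𝓡 n) 𝓘(ℝ, ℝ) f y := f.contMDiff.mdifferentiable (by simp) y
  have h := mvfderiv_smul (I := 𝓡 n) (a := fun _ : M => c) mdifferentiableAt_const hf
  rw [mvfderiv_const] at h
  have h' := DFunLike.congr_fun h (X y)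
  simp only [add_apply, ContinuousLinearMap.smulRight_apply] at h'
  refine h'.trans ?_
  rw [zero_apply, zero_smul, add_zero]
  rfl

theorem symDiffPow_add (nab : AffineConnection n M) [nab.ContMDiffCovariantDerivative ∞] (k : ℕ)
    (f g : Smooth n M) : symDiffPow nab k (f + g) = symDiffPow nab k f + symDiffPow nab k g := by
  induction k with
  | zero => rfl
  | succ k ih =>
    funext X
    simp only [symDiffPow, ih, symmetrize, covDiff, Pi.add_apply, lieFn_add, ← smul_add,
      ← Finset.sum_add_distrib]
    congr 1
    exact Finset.sum_congr rfl fun p _ => by rw [Finset.sum_add_distrib]; abel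

theorem symDiffPow_smul (nab : AffineConnection n M) [nab.ContMDiffCovariantDerivative ∞] (k : ℕ)
    (c : ℝ) (f : Smooth n M) : symDiffPow nab k (c • f) = c • symDiffPow nab k f := by
  induction k with
  | zero => rfl
  | succ k ih =>
    funext X
    simp only [symDiffPow, ih, symmetrize, covDiff, Pi.smul_apply, lieFn_smul]
    rw [smul_comm c]
    simp only [smul_sub, Finset.smul_sum]

end Connection

/-! ### Quantization and total symbols -/

section Quantization

variable [T2Space M] [IsManifold (𝓡 n) ∞ M]

/-- A smooth vector field on `M` whose value at `x` is the `i`-th basis vector of `T_x M` in the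
chart at `x`. -/
def frame (x : M) (i : Fin n) : VF n M :=
  ⟨fun y => bump (n := n) x y •
      FiberBundle.extend (EuclideanSpace ℝ (Fin n)) (E := (TangentSpace (𝓡 n) : M → Type))
        (EuclideanSpace.single i (1 : ℝ) : EuclideanSpace ℝ (Fin n)) y, by
    set v : TangentSpace (𝓡 n) x := (EuclideanSpace.single i (1 : ℝ) : EuclideanSpace ℝ (Fin n))
    have hs : ContMDiffOn (𝓡 n) (𝓡 n).tangent ∞
        (fun y => (⟨y, FiberBundle.extend (EuclideanSpace ℝ (Fin n)) v y⟩ :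
          TangentBundle (𝓡 n) M)) (chartAt (EuclideanSpace ℝ (Fin n)) x).source := by
      intro y hy
      set t := trivializationAt (EuclideanSpace ℝ (Fin n)) (TangentSpace (𝓡 n) : M → Type) x
      have hy' : y ∈ t.baseSet := hy
      rw [t.contMDiffWithinAt_section _ hy']
      have hc : ContMDiffOn (𝓡 n) 𝓘(ℝ, EuclideanSpace ℝ (Fin n)) ∞
          (fun _ : M => (t ⟨x, v⟩).2) t.baseSet := contMDiffOn_const
      refine (hc.congr fun z hz => ?_) y hy'
      change (t ⟨z, t.symm z (t ⟨x, v⟩).2⟩).2 = (t ⟨x, v⟩).2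
      rw [t.apply_mk_symm hz]
    exact ContMDiffOn.smul_section_of_tsupport (bump (n := n) x).contMDiff.contMDiffOn
      (chartAt _ x).open_source (bump (n := n) x).tsupport_subset_chartAt_source hs⟩

/-- The `i`-th element of the basis of `T_x^* M` dual to `frame x · x`. -/
def coframe (x : M) (i : Fin n) : Cotangent (n := n) x :=
  (EuclideanSpace.proj i : EuclideanSpace ℝ (Fin n) →L[ℝ] ℝ)

/-- The standard pairing at `x` of `H ∈ S^k T_x M` and a symmetric covariant tensor `η`,
normalised by `⟨X_1 ⋯ X_k, η⟩ = ∑_π η(X_{π 1}, …, X_{π k})`, so that `⟨H, θ^k⟩ = k! H(θ, …, θ)`. -/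
def pairing {k : ℕ} (x : M) (H : ContraTensor (n := n) k x) (η : CovField n M k) : ℝ :=
  (Nat.factorial k : ℝ) * ∑ J : Fin k → Fin n,
    H (fun m => coframe x (J m)) * η (fun m => frame x (J m)) x

/-- The quantization `Q(H) f = (1 / k!) ⟨H, (d_∇^s)^k f⟩` of a contravariant symmetric
tensor field `H` of degree `k`. -/
def quantize (nab : AffineConnection n M) [nab.ContMDiffCovariantDerivative ∞] {k : ℕ}
    (H : (x : M) → ContraTensor (n := n) k x) : Smooth n M →ₗ[ℝ] (M → ℝ) where
  toFun f := fun x => ((Nat.factorial k : ℝ)⁻¹) * pairing x (H x) (symDiffPow nab k f)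
  map_add' f g := by
    ext x
    simp only [symDiffPow_add, pairing, Pi.add_apply, ContMDiffMap.coe_add]
    simp only [mul_add, Finset.sum_add_distrib]
  map_smul' c f := by
    ext x
    simp only [symDiffPow_smul, pairing, Pi.smul_apply, ContMDiffMap.coe_smul, smul_eq_mul,
      RingHom.id_apply, Finset.mul_sum]
    exact Finset.sum_congr rfl fun J _ => by ring

/-- The successive remainders in the splitting of an operator `A` of order `≤ k`:
`A_0 = A` and `A_{r+1} = A_r - Q(σ)` with `σ` the symbol of degree `k - r` of `A_r`. -/
def remainder (nab : AffineConnection n M) [nab.ContMDiffCovariantDerivative ∞] (k : ℕ)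
    (A : Smooth n M →ₗ[ℝ] Smooth n M) : ℕ → (Smooth n M →ₗ[ℝ] (M → ℝ))
  | 0 => toFunOp A
  | r + 1 => remainder nab k A r - quantize nab (smbl (k - r) (remainder nab k A r))

/-- The total symbol `[σ_A, σ_{k-1}, …, σ_0]` of an operator `A` of order `≤ k` with respect to
`∇`; the component `j` is the symbol of degree `j` of the remainder `A_{k-j}`. -/
def totalSymbol (nab : AffineConnection n M) [nab.ContMDiffCovariantDerivative ∞] (k : ℕ)
    (A : Smooth n M →ₗ[ℝ] Smooth n M) (j : Fin (k + 1)) (x : M) : ContraTensor (n := n) j x :=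
  smbl j (remainder nab k A (k - j)) x

/-- The principal symbol `σ_A` of an operator `A` of order `≤ k`. -/
def principalSymbol (k : ℕ) (A : Smooth n M →ₗ[ℝ] Smooth n M) (x : M) :
    ContraTensor (n := n) k x :=
  smbl k (toFunOp A) x

end Quantization

/-! ### Parallel transport -/

section Transport

variable [IsManifold (𝓡 n) ∞ M]

/-- The vector field `V` along the curve `γ` is parallel: `D V / dt = 0`. At the time `t` the
covariant derivative along `γ` is written in the trivialization of `TM` at `γ t`, where
`FiberBundle.extend _ (V t)` is the field with constant coefficients through `V t`. -/
def IsParallelAlong (nab : AffineConnection n M) (γ : ℝ → M)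
    (V : (t : ℝ) → TangentSpace (𝓡 n) (γ t)) : Prop :=
  ∀ t : ℝ, HasDerivAt
    (fun s : ℝ => (trivializationAt (EuclideanSpace ℝ (Fin n))
      (TangentSpace (𝓡 n) : M → Type) (γ t) ⟨γ s, V s⟩).2)
    (-(nab (FiberBundle.extend (EuclideanSpace ℝ (Fin n)) (V t)) (γ t)
      (mfderiv 𝓘(ℝ, ℝ) (𝓡 n) γ t (1 : ℝ))) : EuclideanSpace ℝ (Fin n)) t

/-- `P t : T_{γ 0} M → T_{γ t} M` is the parallel transport of `∇` along `γ`. -/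
def IsParallelTransport (nab : AffineConnection n M) (γ : ℝ → M)
    (P : (t : ℝ) → TangentSpace (𝓡 n) (γ 0) →L[ℝ] TangentSpace (𝓡 n) (γ t)) : Prop :=
  P 0 = ContinuousLinearMap.id ℝ _ ∧ ∀ v, IsParallelAlong nab γ fun t => P t v

end Transport

/-! ### Pseudogroups -/

section Pseudogroup

variable (Γ : StructureGroupoid M)

/-- `Γ` is a pseudogroup of smooth local diffeomorphisms of `M`, i.e. of diffeomorphisms between
open subsets of `M`. A `StructureGroupoid` is closed under composition, inverses and gluing and
contains the identity. -/
structure IsSmoothPseudogroup : Prop where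
  restr : ∀ φ ∈ Γ, ∀ U : Set M, IsOpen U → φ.restr U ∈ Γ
  smooth : ∀ φ ∈ Γ, ContMDiffOn (𝓡 n) (𝓡 n) ∞ φ φ.source

/-- `Γ` acts transitively on `M`. -/
def IsTransitive : Prop :=
  ∀ a b : M, ∃ φ ∈ Γ, a ∈ φ.source ∧ φ a = b

/-- `G_1(a, b)`: the differentials at `a` of the elements of `Γ` which map `a` to `b`. For `a = b`
this is the linear isotropy group `G_1(a)`. (As `φ a = b`, both sides of the last equation are
maps `T_a M → T_b M`; tangent spaces are copies of `ℝ^n`.) -/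
def jets (a b : M) : Set (TangentSpace (𝓡 n) a →L[ℝ] TangentSpace (𝓡 n) b) :=
  {L | ∃ φ ∈ Γ, a ∈ φ.source ∧ φ a = b ∧
    (mfderiv (𝓡 n) (𝓡 n) φ a : EuclideanSpace ℝ (Fin n) →L[ℝ] EuclideanSpace ℝ (Fin n)) = L}

/-- The orbit of `σ ∈ S^k T_a M` under the linear isotropy group `G_1(a)`. -/
def orbit {k : ℕ} {a : M} (σ : ContraTensor (n := n) k a) : Set (ContraTensor (n := n) k a) :=
  {τ | ∃ L ∈ jets Γ a a, τ = pushTensor L σ}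

/-- The stabilizer of `σ ∈ S^k T_a M` in the linear isotropy group `G_1(a)`. -/
def stabilizer {k : ℕ} {a : M} (σ : ContraTensor (n := n) k a) :
    Set (TangentSpace (𝓡 n) a →L[ℝ] TangentSpace (𝓡 n) a) :=
  {L | L ∈ jets Γ a a ∧ pushTensor L σ = σ}

/-- The symmetric tensor field `σ` has constant `Γ`-type: each element of `G_1(a, b)` maps the
`G_1(a)`-orbit of `σ a` onto the `G_1(b)`-orbit of `σ b`. -/
def HasConstantType {k : ℕ} (σ : (x : M) → ContraTensor (n := n) k x) : Prop :=
  ∀ a b : M, ∀ L ∈ jets Γ a b, pushTensor L '' orbit Γ (σ a) = orbit Γ (σ b)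

variable [IsManifold (𝓡 n) ∞ M]

/-- `∇` is a `Γ`-connection: the parallel transport along each smooth path (which always exists
and is unique) consists of elements of the sets `G_1(a, b)`. -/
def IsGammaConnection (nab : AffineConnection n M) : Prop :=
  ∀ γ : ℝ → M, ContMDiff 𝓘(ℝ, ℝ) (𝓡 n) ∞ γ →
    ∃ P, IsParallelTransport nab γ P ∧ ∀ t, P t ∈ jets Γ (γ 0) (γ t)

/-- The parallel transports of `∇` preserve the symmetric tensor field `σ`. -/
def PreservesTensor (nab : AffineConnection n M) {k : ℕ}
    (σ : (x : M) → ContraTensor (n := n) k x) : Prop :=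
  ∀ γ : ℝ → M, ContMDiff 𝓘(ℝ, ℝ) (𝓡 n) ∞ γ →
    ∀ P, IsParallelTransport nab γ P → ∀ t, pushTensor (P t) (σ (γ 0)) = σ (γ t)

variable [T2Space M]

/-- `∇` is the Wagner connection of an operator `A` of order `≤ k`: a smooth affine
`Γ`-connection that preserves the principal symbol of `A`. -/
structure IsWagnerConnection (k : ℕ) (A : Smooth n M →ₗ[ℝ] Smooth n M)
    (nab : AffineConnection n M) [nab.ContMDiffCovariantDerivative ∞] : Prop where
  isGamma : IsGammaConnection Γ nab
  preserves : PreservesTensor nab (principalSymbol k A)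

/-- The operators `A` and `B` are `Γ`-equivalent in the open sets `U` and `V`: some `φ ∈ Γ` with
domain `U` and image `V` carries `A` restricted to `U` to `B` restricted to `V`, that is
`(B f) ∘ φ = A (f ∘ φ)`. Differential operators being local, `f ∘ φ` is replaced near each point
of `U` by a globally defined function `g` with the same germ. -/
def OperatorsEquivalent (A B : Smooth n M →ₗ[ℝ] Smooth n M) (U V : Set M) : Prop :=
  ∃ φ ∈ Γ, φ.source = U ∧ φ.target = V ∧
    ∀ x ∈ U, ∀ f g : Smooth n M, ⇑g =ᶠ[𝓝 x] ⇑f ∘ φ → A g x = B f (φ x)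

/-- The total symbols `σ` and `τ` (families of symmetric tensor fields of degrees `0, …, k`) are
`Γ`-equivalent in the open sets `U` and `V`: some `φ ∈ Γ` with domain `U` and image `V` carries
all components of `σ` restricted to `U` to those of `τ` restricted to `V`. -/
def SymbolsEquivalent {k : ℕ}
    (σ τ : (j : Fin (k + 1)) → (x : M) → ContraTensor (n := n) j x) (U V : Set M) : Prop :=
  ∃ φ ∈ Γ, φ.source = U ∧ φ.target = V ∧
    ∀ x ∈ U, ∀ j, pushTensor (mfderiv (𝓡 n) (𝓡 n) φ x) (σ j x) = τ j (φ x)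

end Pseudogroup

end GammaOp

end

noncomputable section

set_option linter.unusedSectionVars false

namespace GammaOp

/-! ### Hadamard's lemma -/

section Hadamard

open MeasureTheory

/-! Everything used is natural under elements of `Γ`. Suppose that some `φ ∈ Γ` carries one
principal symbol to the other. Along a curve `γ` in the source of `φ`, compare the transport of the
second connection along `φ ∘ γ` with the image under `dφ` of the transport of the first along `γ`.
Both lie in the sets `jets` and respect the symbols, so they differ by an element of the stabilizer
of the symbol at `γ 0`. At time zero this element is the identity; since the stabilizer is finite,
continuity forces it to remain so for small times (`eventually_transport_comm`). A covariant
derivative is the derivative of a field moved back by parallel transport, hence `φ` carries the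
first Wagner connection to the second (`IsWagnerConnection.connRel`).

Once the connections correspond, so do symmetrised differentials and quantizations
(`quantize_natural`). If the operators correspond, their principal symbols do, and induction on the
remainders gives all further symbols. If the total symbols correspond, their top components are the
principal symbols, so the connections again correspond; the operators are then rebuilt as sums of
quantizations, because the last remainder is zero (`remainder_succ_self`).

Remainders take values in arbitrary functions, so commutators with multiplications do not describe
their order. Order is instead measured at each point: `KillsAt x (j + 1) R` says that `R`
annihilates, at `x`, the power `I ^ (j + 1)` of the ideal `I` of functions vanishing at `x`.
Hadamard's lemma identifies functions vanishing to first order with elements of `I ^ 2`, so a symbol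
depends only on differentials (`smbl_eq`). Polarization reduces the claim that `R - Q(symbol)` has
lower order to powers of a single function, on which the leading term of `(d_∇^s)^j` is explicit
(`sub_quantize_smbl_killsAt`).

Operators and tensors act on global functions and fields, while `φ` is only local; correspondence is
therefore expressed by germs, and cutoffs extend every needed germ. -/

theorem contDiff_intervalIntegral_param {E : Type*} [NormedAddCommGroup E] [NormedSpace ℝ E]
    {h : ℝ → E → ℝ} (hh : ContDiff ℝ ∞ (fun q : ℝ × E => h q.1 q.2)) :
    ContDiff ℝ ∞ (fun y => ∫ t in (0 : ℝ)..1, h t y) := by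
  -- The integral is the value at `0` of the convolution of the indicator of `(0, 1]` with `s ↦ χ s
  -- * h (-s) y`. The cutoff makes this kernel compactly supported and equals `1` at every `-t` with
  -- `t ∈ (0, 1]`.
  let χ : ContDiffBump (0 : ℝ) := ⟨2, 3, by norm_num, by norm_num⟩
  have key := contDiffOn_convolution_right_with_param (μ := (volume : Measure ℝ)) (n := ⊤)
    (ContinuousLinearMap.lsmul ℝ ℝ) (f := indicator (Ioc (0 : ℝ) 1) fun _ => (1 : ℝ))
    (g := fun (p : E) (s : ℝ) => χ s * h (-s) p) (s := univ) (k := Metric.closedBall 0 3)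
    isOpen_univ (isCompact_closedBall _ _)
    (fun p s _ hs => by
      have : χ s = 0 := χ.zero_of_le_dist (by
        have := (Metric.mem_closedBall.not.mp hs); exact (not_le.mp this).le)
      simp [this])
    ((integrable_indicator_iff measurableSet_Ioc).mpr
      (integrableOn_const (by simp))).locallyIntegrable
    (by
      have h1 : ContDiff ℝ ∞ (fun q : E × ℝ => χ q.2 * h (-q.2) q.1) :=
        (χ.contDiff.comp contDiff_snd).mul (hh.comp (contDiff_snd.neg.prodMk contDiff_fst))
      exact h1.contDiffOn)
  rw [univ_prod_univ, contDiffOn_univ] at key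
  have key2 := key.comp (contDiff_id.prodMk (contDiff_const (c := (0 : ℝ))) : ContDiff ℝ ∞
    (fun y : E => (y, (0 : ℝ))))
  convert key2 using 1
  funext y
  simp only [Function.comp_def, id, convolution_def]
  rw [intervalIntegral.integral_of_le zero_le_one, ← integral_indicator measurableSet_Ioc]
  refine integral_congr_ae (Eventually.of_forall fun t => ?_)
  by_cases ht : t ∈ Ioc (0 : ℝ) 1
  · have : χ (-t) = 1 := χ.one_of_mem_closedBall (by
      simp only [Metric.mem_closedBall, dist_zero_right, norm_neg, Real.norm_eq_abs]
      rw [abs_of_pos ht.1]; exact ht.2.trans (by norm_num))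
    simp [ht, this]
  · simp [ht]

/-- Hadamard's lemma: the increments of a smooth function are combinations, with smooth
coefficients, of the increments of the coordinates. -/
theorem exists_contDiff_sub_eq_sum {n : ℕ} {F : EuclideanSpace ℝ (Fin n) → ℝ}
    (hF : ContDiff ℝ ∞ F) (c : EuclideanSpace ℝ (Fin n)) :
    ∃ G : Fin n → EuclideanSpace ℝ (Fin n) → ℝ, (∀ i, ContDiff ℝ ∞ (G i)) ∧
      (∀ i, G i c = fderiv ℝ F c (EuclideanSpace.single i 1)) ∧
      ∀ y, F y = F c + ∑ i, (y - c) i * G i y := by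
  have hdF : ContDiff ℝ ∞ (fderiv ℝ F) := hF.fderiv_right (by simp)
  -- The coefficients average the partial derivatives over the segment from `c` to `y`; the
  -- expansion is the fundamental theorem of calculus on that segment.
  refine ⟨fun i y => ∫ t in (0 : ℝ)..1, fderiv ℝ F (c + t • (y - c)) (EuclideanSpace.single i 1),
    fun i => ?_, fun i => by simp, fun y => ?_⟩
  · apply contDiff_intervalIntegral_param
      (h := fun t y => fderiv ℝ F (c + t • (y - c)) (EuclideanSpace.single i 1))
    refine ContDiff.clm_apply (hdF.comp ?_) contDiff_const
    exact contDiff_const.add (contDiff_fst.smul (contDiff_snd.sub contDiff_const))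
  · have hcont : Continuous (fun t : ℝ => fderiv ℝ F (c + t • (y - c))) :=
      hdF.continuous.comp (by fun_prop)
    have h1 : ∫ t in (0 : ℝ)..1, fderiv ℝ F (c + t • (y - c)) (y - c) = F y - F c := by
      have := intervalIntegral.integral_eq_sub_of_hasDerivAt (a := 0) (b := 1)
        (f := fun t : ℝ => F (c + t • (y - c)))
        (f' := fun t : ℝ => fderiv ℝ F (c + t • (y - c)) (y - c)) (fun t _ => by
          have h2 := (hF.differentiable (by simp)) (c + t • (y - c))
          have h3 : HasDerivAt (fun t : ℝ => c + t • (y - c)) (y - c) t := by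
            simpa using ((hasDerivAt_id t).smul_const (y - c)).const_add c
          exact h2.hasFDerivAt.comp_hasDerivAt t h3)
        ((hcont.clm_apply continuous_const).intervalIntegrable _ _)
      simpa using this
    have h2 : y - c = ∑ i, (y - c) i • EuclideanSpace.single i (1 : ℝ) := by
      ext j; simp [Finset.sum_apply, Pi.single_apply]
    have h3 : ∀ t : ℝ, fderiv ℝ F (c + t • (y - c)) (y - c) =
        ∑ i, (y - c) i * fderiv ℝ F (c + t • (y - c)) (EuclideanSpace.single i 1) := by
      intro t
      generalize fderiv ℝ F (c + t • (y - c)) = T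
      conv_lhs => rw [h2, map_sum]
      simp only [map_smul, smul_eq_mul]
    rw [← sub_eq_iff_eq_add', ← h1]
    simp only [h3]
    rw [intervalIntegral.integral_finsetSum]
    · simp only [intervalIntegral.integral_const_mul]
    · intro i _
      exact ((hcont.clm_apply continuous_const).const_mul _).intervalIntegrable _ _

end Hadamard

/-! ### Germs and vanishing ideals -/

section Germs

variable {n : ℕ} {M : Type*} [TopologicalSpace M] [ChartedSpace (EuclideanSpace ℝ (Fin n)) M]

/-- The ideal of smooth functions vanishing at `x`. -/
def vanishIdeal (x : M) : Ideal (Smooth n M) where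
  carrier := {f | f x = 0}
  add_mem' {f g} hf hg := by
    change f x + g x = 0
    rw [show f x = 0 from hf, show g x = 0 from hg, add_zero]
  zero_mem' := rfl
  smul_mem' c f hf := by
    change c x * f x = 0
    rw [show f x = 0 from hf, mul_zero]

theorem mem_vanishIdeal {x : M} {f : Smooth n M} : f ∈ vanishIdeal x ↔ f x = 0 := Iff.rfl

theorem sum_smooth_apply {ι : Type*} (s : Finset ι) (f : ι → Smooth n M) (y : M) :
    (∑ i ∈ s, f i) y = ∑ i ∈ s, f i y :=
  map_sum (ContMDiffMap.evalRingHom (I := 𝓡 n) (n := ∞) (I' := 𝓘(ℝ, ℝ)) (R := ℝ) y) f s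

theorem apply_eq_zero_of_mem_pow_succ {x : M} {f : Smooth n M} {m : ℕ}
    (hf : f ∈ vanishIdeal x ^ (m + 1)) : f x = 0 :=
  Ideal.pow_le_self (Nat.succ_ne_zero m) hf

theorem bump_eventually_eq_one (x : M) : ∀ᶠ y in 𝓝 x, bump (n := n) x y = 1 :=
  (bump (n := n) x).eventuallyEq_one

theorem mvfderiv_eq_fderiv {f : M → ℝ} {x : M} (hf : MDifferentiableAt (𝓡 n) 𝓘(ℝ, ℝ) f x) :
    mvfderiv (𝓡 n) f x = (fderiv ℝ (f ∘ (extChartAt (𝓡 n) x).symm) (extChartAt (𝓡 n) x x) :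
      EuclideanSpace ℝ (Fin n) →L[ℝ] ℝ) := by
  have := hf.mfderiv
  simp [mvfderiv, mfderiv, hf, writtenInExtChartAt, fderivWithin_univ]
  rfl

variable [T2Space M] [IsManifold (𝓡 n) ∞ M]

theorem exists_cutoff {x : M} {s : Set M} (hs : s ∈ 𝓝 x) :
    ∃ b : Smooth n M, (∀ᶠ y in 𝓝 x, b y = 1) ∧ tsupport b ⊆ s := by
  obtain ⟨b, -, hb⟩ := (SmoothBumpFunction.nhds_basis_tsupport (I := 𝓡 n) x).mem_iff.mp hs
  exact ⟨⟨b, b.contMDiff⟩, b.eventuallyEq_one, hb⟩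

/-- For a cutoff `b` equal to `1` near `x` and supported where `f` is zero, `f = f * (1 - b) ^ m`,
and `1 - b` vanishes at `x`. This makes membership in powers of the ideal a property of germs. -/
theorem mem_vanishIdeal_pow_of_eventually {x : M} {f : Smooth n M} (hf : ∀ᶠ y in 𝓝 x, f y = 0)
    (m : ℕ) : f ∈ vanishIdeal x ^ m := by
  obtain ⟨b, hb, hbs⟩ := exists_cutoff (n := n) hf
  have hfb : f = f * (1 - b) ^ m := by
    ext y
    change f y = f y * (1 - b y) ^ m
    by_cases hy : f y = 0
    · rw [hy, zero_mul]
    · rw [image_eq_zero_of_notMem_tsupport fun h => hy (hbs h), sub_zero, one_pow, mul_one]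
  rw [hfb]
  refine Ideal.mul_mem_left _ _ (Ideal.pow_mem_pow ?_ m)
  change 1 - b x = 0
  rw [hb.self_of_nhds, sub_self]

/-- A function which is smooth near `x` has the germ of a globally smooth function. -/
theorem exists_smooth_germ {x : M} {f : M → ℝ} {s : Set M} (hs : IsOpen s) (hx : x ∈ s)
    (hf : ContMDiffOn (𝓡 n) 𝓘(ℝ, ℝ) ∞ f s) : ∃ g : Smooth n M, ⇑g =ᶠ[𝓝 x] f := by
  obtain ⟨b, hb, hbs⟩ := exists_cutoff (n := n) (hs.mem_nhds hx)
  have hsm : ContMDiff (𝓡 n) 𝓘(ℝ, ℝ) ∞ (fun y => b y • f y) := by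
    refine contMDiff_of_tsupport fun y hy => ?_
    have hys : y ∈ s := hbs (tsupport_smul_subset_left _ _ hy)
    exact (b.contMDiff y).smul ((hf y hys).contMDiffAt (hs.mem_nhds hys))
  exact ⟨⟨_, hsm⟩, hb.mono fun y hy => by change b y • f y = f y; rw [hy, one_smul]⟩

/-- A vector field which is smooth near `x` has the germ of a globally smooth vector field. -/
theorem exists_vf_germ {x : M} {X : (y : M) → TangentSpace (𝓡 n) y} {s : Set M} (hs : IsOpen s)
    (hx : x ∈ s) (hX : ContMDiffOn (𝓡 n) (𝓡 n).tangent ∞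
      (fun y => (⟨y, X y⟩ : TangentBundle (𝓡 n) M)) s) :
    ∃ Y : VF n M, ∀ᶠ y in 𝓝 x, Y y = X y := by
  obtain ⟨b, hb, hbs⟩ := exists_cutoff (n := n) (hs.mem_nhds hx)
  exact ⟨⟨fun y => b y • X y,
    ContMDiffOn.smul_section_of_tsupport b.contMDiff.contMDiffOn hs hbs hX⟩,
    hb.mono fun y hy => by change b y • X y = X y; rw [hy, one_smul]⟩

theorem testFn_apply (x : M) (θ : Cotangent (n := n) x) (y : M) :
    testFn x θ y = bump (n := n) x y *
      (θ : EuclideanSpace ℝ (Fin n) →L[ℝ] ℝ) (extChartAt (𝓡 n) x y - extChartAt (𝓡 n) x x) :=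
  rfl

theorem testFn_apply_self (x : M) (θ : Cotangent (n := n) x) : testFn x θ x = 0 := by
  let θ' : EuclideanSpace ℝ (Fin n) →L[ℝ] ℝ := θ
  change bump (n := n) x x * θ' (extChartAt (𝓡 n) x x - extChartAt (𝓡 n) x x) = 0
  rw [sub_self, map_zero, mul_zero]

theorem mvfderiv_testFn (x : M) (θ : Cotangent (n := n) x) :
    mvfderiv (𝓡 n) (testFn x θ) x = θ := by
  rw [mvfderiv_eq_fderiv (testFn x θ).mdifferentiableAt]
  set c := extChartAt (𝓡 n) x x
  have h1 : (testFn x θ ∘ (extChartAt (𝓡 n) x).symm) =ᶠ[𝓝 c]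
      fun y => (θ : EuclideanSpace ℝ (Fin n) →L[ℝ] ℝ) (y - c) := by
    have h2 : ContinuousAt (extChartAt (𝓡 n) x).symm c := continuousAt_extChartAt_symm x
    have h3 : (extChartAt (𝓡 n) x).symm c = x := extChartAt_to_inv x
    rw [ContinuousAt, h3] at h2
    filter_upwards [h2.eventually (bump_eventually_eq_one (n := n) x),
      extChartAt_target_mem_nhds (I := 𝓡 n) x] with y hy hyt
    rw [Function.comp_apply, testFn_apply, hy, one_mul, (extChartAt (𝓡 n) x).right_inv hyt]
  rw [h1.fderiv_eq]
  let θ' : EuclideanSpace ℝ (Fin n) →L[ℝ] ℝ := θ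
  have h4 : HasFDerivAt (fun y => θ' (y - c)) θ' c :=
    θ'.hasFDerivAt.comp c ((hasFDerivAt_id c).sub_const c)
  exact h4.fderiv

/-- A smooth function vanishing to first order at `x` lies in the square of the ideal of
functions vanishing at `x`. -/
theorem mem_vanishIdeal_sq {x : M} {f : Smooth n M} (hf : f x = 0)
    (hdf : mvfderiv (𝓡 n) f x = 0) : f ∈ vanishIdeal x ^ 2 := by
  set c := extChartAt (𝓡 n) x x with hc
  set e := extChartAt (𝓡 n) x
  set β := bump (n := n) x
  -- The cutoff turns the chart expression of `f` into a function smooth on the whole model space,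
  -- as Hadamard's lemma requires, without changing its germ.
  let F : EuclideanSpace ℝ (Fin n) → ℝ := fun y => β.toContDiffBump y * f (e.symm y)
  have hF : ContDiff ℝ ∞ F := by
    rw [contDiff_iff_contDiffAt]
    intro y
    by_cases hy : y ∈ Metric.closedBall c β.rOut
    · have hyt : y ∈ e.target := β.closedBall_subset ⟨hy, by simp⟩
      have h1 : ContMDiffAt 𝓘(ℝ, EuclideanSpace ℝ (Fin n)) 𝓘(ℝ, ℝ) ∞ (f ∘ e.symm) y :=
        f.contMDiff.contMDiffAt.comp y
          ((contMDiffOn_extChartAt_symm x y hyt).contMDiffAt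
            ((isOpen_extChartAt_target (I := 𝓡 n) x).mem_nhds hyt))
      exact β.toContDiffBump.contDiffAt.mul h1.contDiffAt
    · refine (contDiffAt_const (c := (0 : ℝ))).congr_of_eventuallyEq ?_
      filter_upwards [Metric.isClosed_closedBall.isOpen_compl.mem_nhds hy] with z hz
      change β.toContDiffBump z * _ = 0
      rw [β.toContDiffBump.zero_of_le_dist (not_le.mp (Metric.mem_closedBall.not.mp hz)).le, zero_mul]
  have hFf : F =ᶠ[𝓝 c] (f ∘ e.symm) := by
    filter_upwards [β.toContDiffBump.eventuallyEq_one] with y hy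
    change β.toContDiffBump y * f (e.symm y) = f (e.symm y)
    rw [hy, Pi.one_apply, one_mul]
  obtain ⟨G, hG, hGc, hFG⟩ := exists_contDiff_sub_eq_sum hF c
  have hFc : F c = 0 := by rw [hFf.self_of_nhds, Function.comp_apply, extChartAt_to_inv, hf]
  have hdF : fderiv ℝ F c = 0 := by
    rw [hFf.fderiv_eq, ← mvfderiv_eq_fderiv f.mdifferentiableAt]
    exact hdf
  have hv : ∀ i, ∃ g : Smooth n M, ⇑g =ᶠ[𝓝 x] fun y => G i (e y) := fun i =>
    exists_smooth_germ (chartAt _ x).open_source (mem_chart_source _ x)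
      ((hG i).contMDiff.comp_contMDiffOn contMDiffOn_extChartAt)
  choose g hg using hv
  -- Hadamard's expansion holds only near `x`, but a function vanishing near `x` lies in every power
  -- of the ideal.
  have hsum : f - ∑ i, testFn x (coframe x i) * g i ∈ vanishIdeal x ^ 2 := by
    apply mem_vanishIdeal_pow_of_eventually
    have h1 : ∀ᶠ y in 𝓝 x, F (e y) = f y := by
      filter_upwards [(continuousAt_extChartAt (I := 𝓡 n) x).eventually hFf,
        extChartAt_source_mem_nhds (I := 𝓡 n) x] with y hy hys
      rw [hy, Function.comp_apply, e.left_inv hys]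
    filter_upwards [h1, bump_eventually_eq_one (n := n) x, eventually_all.mpr hg] with y hy hb hgy
    have h2 : (f - ∑ i, testFn x (coframe x i) * g i) y =
        f y - ∑ i, testFn x (coframe x i) y * g i y := by
      change f y - (∑ i, testFn x (coframe x i) * g i : Smooth n M) y = _
      rw [sum_smooth_apply]
      rfl
    rw [h2, ← hy, hFG, hFc, zero_add, sub_eq_zero]
    refine Finset.sum_congr rfl fun i _ => ?_
    rw [testFn_apply, hb, one_mul, hgy i]
    rfl
  -- Each summand has two factors vanishing at `x`: the coordinate, and the Hadamard coefficient,
  -- whose value there is a partial derivative of `F`, zero by assumption.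
  have hmem : ∑ i, testFn x (coframe x i) * g i ∈ vanishIdeal x ^ 2 := by
    refine Ideal.sum_mem _ fun i _ => ?_
    rw [pow_two]
    refine Ideal.mul_mem_mul (testFn_apply_self x _) ?_
    change g i x = 0
    rw [(hg i).self_of_nhds]
    change G i c = 0
    rw [hGc, hdF]; rfl
  have := Ideal.add_mem _ hsum hmem
  rwa [sub_add_cancel] at this

end Germs

/-! ### Orders of vanishing -/

section Orders

variable {n : ℕ} {M : Type*} [TopologicalSpace M] [ChartedSpace (EuclideanSpace ℝ (Fin n)) M]

/-- A differential operator of order `≤ k` kills, at `x`, the functions vanishing at `x` to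
order `k + 1`. -/
theorem IsDiffOp.apply_eq_zero {k : ℕ} {A : Smooth n M →ₗ[ℝ] Smooth n M} (hA : IsDiffOp k A)
    {x : M} {f : Smooth n M} (hf : f ∈ vanishIdeal x ^ (k + 1)) : A f x = 0 := by
  induction k generalizing A f with
  | zero =>
    have h := congrArg (fun B => (B 1 : Smooth n M) x) (hA f)
    have h' : A (f * 1) x - f x * A 1 x = 0 := h
    rw [mul_one, apply_eq_zero_of_mem_pow_succ hf, zero_mul, sub_zero] at h'
    exact h'
  | succ k ih =>
    rw [pow_succ'] at hf
    induction hf using Submodule.mul_induction_on' with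
    | mem_mul_mem g hg h hh =>
      -- The commutator with `g` has order `≤ k` and kills `h` at `x`; since `g x = 0`, this leaves
      -- `A (g * h) x = 0`.
      have h1 := ih (hA g) hh
      have h1' : A (g * h) x - g x * A h x = 0 := h1
      rw [mem_vanishIdeal.mp hg, zero_mul, sub_zero] at h1'
      exact h1'
    | add f _ g _ hf hg =>
      rw [map_add]
      change A f x + A g x = 0
      rw [hf, hg, add_zero]

/-- The polynomial `t ↦ D ((f + t g) ^ (a + 1) * h)` is identically zero, and its coefficient of `t`
is `(a + 1) * D (f ^ a * (g * h))`. -/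
theorem polarization_succ {R : Type*} [CommRing R] [Algebra ℝ R] {I : Ideal R} (D : R →ₗ[ℝ] ℝ)
    {a : ℕ} {h : R} (hD : ∀ f ∈ I, D (f ^ (a + 1) * h) = 0) {f g : R} (hf : f ∈ I) (hg : g ∈ I) :
    D (f ^ a * (g * h)) = 0 := by
  have h1 : ∀ t : ℝ, D ((f + t • g) ^ (a + 1) * h) = 0 := fun t =>
    hD _ (I.add_mem hf (by rw [Algebra.smul_def]; exact I.mul_mem_left _ hg))
  let p : Polynomial ℝ := ∑ m ∈ Finset.range (a + 1 + 1),
    Polynomial.monomial m (D (f ^ (a + 1 - m) * g ^ m * ((a + 1).choose m : R) * h))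
  have hp : p = 0 := by
    refine Polynomial.funext fun t => ?_
    rw [Polynomial.eval_zero, ← h1 t, add_comm f, add_pow, Finset.sum_mul, map_sum,
      Polynomial.eval_finsetSum]
    refine Finset.sum_congr rfl fun m _ => ?_
    rw [Polynomial.eval_monomial, mul_comm, ← smul_eq_mul, ← map_smul, smul_pow]
    congr 1
    simp only [Algebra.smul_def]
    ring
  have h2 := congrArg (fun q => Polynomial.coeff q 1) hp
  simp only [p, Polynomial.finsetSum_coeff, Polynomial.coeff_monomial, Polynomial.coeff_zero] at h2
  rw [Finset.sum_ite_eq'] at h2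
  rw [if_pos (by simp), Nat.choose_one_right, Nat.add_sub_cancel, pow_one,
    show f ^ a * g * ((a + 1 : ℕ) : R) * h = ((a + 1 : ℕ) : ℝ) • (f ^ a * (g * h)) by
      rw [Algebra.smul_def, map_natCast]; ring, map_smul, smul_eq_mul] at h2
  exact (mul_eq_zero.mp h2).resolve_left (by positivity)

/-- Polarization: a linear form vanishing on the `(j + 1)`-st powers of the elements of an ideal
vanishes on the `(j + 1)`-st power of the ideal. -/
theorem eq_zero_of_forall_pow {R : Type*} [CommRing R] [Algebra ℝ R] {I : Ideal R} (D : R →ₗ[ℝ] ℝ)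
    {j : ℕ} (hD : ∀ f ∈ I, D (f ^ (j + 1)) = 0) {f : R} (hf : f ∈ I ^ (j + 1)) : D f = 0 := by
  -- Here `i + 1` counts the factors already allowed to be arbitrary and `a` the equal ones left,
  -- with `i + 1 + a = j + 1`; each step trades one equal factor for an arbitrary one. At the end `a
  -- = 0`.
  have key : ∀ i a : ℕ, i + a = j → ∀ h ∈ I ^ (i + 1), ∀ f ∈ I, D (f ^ a * h) = 0 := by
    intro i
    induction i with
    | zero =>
      intro a ha h hh g hg
      rw [zero_add] at ha
      rw [zero_add, pow_one] at hh
      have := polarization_succ D (a := a) (h := 1)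
        (fun f hf => by rw [mul_one, ha]; exact hD f hf) hg hh
      rwa [mul_one] at this
    | succ i ih =>
      intro a ha h hh f hf
      rw [pow_succ'] at hh
      induction hh using Submodule.mul_induction_on' with
      | mem_mul_mem g hg h hh =>
        exact polarization_succ D (fun f hf => ih (a + 1) (by omega) h hh f hf) hf hg
      | add h _ h' _ hh hh' => rw [mul_add, map_add, hh, hh', add_zero]
  simpa using key j 0 rfl f hf 0 I.zero_mem

theorem real_smul_mem {I : Ideal (Smooth n M)} {f : Smooth n M} (c : ℝ) (hf : f ∈ I) :
    c • f ∈ I := by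
  rw [Algebra.smul_def]
  exact I.mul_mem_left _ hf

end Orders

/-! ### Loss of vanishing order under covariant differentials -/

section Derivations

variable {n : ℕ} {M : Type*} [TopologicalSpace M] [ChartedSpace (EuclideanSpace ℝ (Fin n)) M]
  [IsManifold (𝓡 n) ∞ M]

theorem lieFn_mul (X : VF n M) (f g : Smooth n M) :
    lieFn X (f * g) = f * lieFn X g + g * lieFn X f := by
  ext y
  have h := mvfderiv_mul (I := 𝓡 n) (f.mdifferentiableAt (x := y)) (g.mdifferentiableAt (x := y))
  exact DFunLike.congr_fun h (X y)

theorem lieFn_apply (X : VF n M) (f : Smooth n M) (y : M) :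
    lieFn X f y = mvfderiv (𝓡 n) f y (X y) := rfl

theorem lieFn_pow_succ (X : VF n M) (f : Smooth n M) (m : ℕ) :
    lieFn X (f ^ (m + 1)) = ((m + 1 : ℕ) : ℝ) • (f ^ m * lieFn X f) := by
  induction m with
  | zero => simp
  | succ m ih =>
    rw [pow_succ, lieFn_mul, ih]
    simp only [Algebra.smul_def, map_natCast]
    push_cast
    ring

theorem lieFn_mem {X : VF n M} {x : M} {m : ℕ} {f : Smooth n M}
    (hf : f ∈ vanishIdeal x ^ (m + 1)) : lieFn X f ∈ vanishIdeal x ^ m := by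
  induction m generalizing f with
  | zero => simp
  | succ m ih =>
    rw [pow_succ'] at hf
    induction hf using Submodule.mul_induction_on' with
    | mem_mul_mem g hg h hh =>
      rw [lieFn_mul]
      refine Ideal.add_mem _ ?_ (Ideal.mul_mem_right _ _ hh)
      rw [pow_succ']
      exact Ideal.mul_mem_mul hg (ih hh)
    | add f _ g _ hf hg =>
      rw [lieFn_add]
      exact Ideal.add_mem _ hf hg

variable (nab : AffineConnection n M) [nab.ContMDiffCovariantDerivative ∞]

/-- Each covariant differential lowers the order of vanishing by at most one: the derivative along a
field costs one order, the connection terms none. -/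
theorem symDiffPow_mem {x : M} (j m : ℕ) {f : Smooth n M} (hf : f ∈ vanishIdeal x ^ (m + j))
    (X : Fin j → VF n M) : symDiffPow nab j f X ∈ vanishIdeal x ^ m := by
  induction j generalizing m with
  | zero => exact hf
  | succ j ih =>
    have hf1 : f ∈ vanishIdeal x ^ (m + 1 + j) := by rwa [add_assoc, add_comm 1 j]
    refine real_smul_mem _ (Ideal.sum_mem _ fun p _ => ?_)
    refine Ideal.sub_mem _ (lieFn_mem (ih (m + 1) hf1 _)) (Ideal.sum_mem _ fun i _ => ?_)
    exact Ideal.pow_le_pow_right (Nat.le_succ m) (ih (m + 1) hf1 _)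

/-- The leading term of `(d_∇^s)^j` on powers of functions vanishing at `x`. -/
theorem symDiffPow_pow_sub_mem {x : M} (j m : ℕ) {f : Smooth n M} (hf : f ∈ vanishIdeal x)
    (X : Fin j → VF n M) :
    symDiffPow nab j (f ^ (m + j)) X -
      ((m + j).descFactorial j : ℝ) • (f ^ m * ∏ i, lieFn (X i) f) ∈ vanishIdeal x ^ (m + 1) := by
  induction j generalizing m with
  | zero => simp [symDiffPow]
  | succ j ih =>
    have hterm : ∀ Y : Fin (j + 1) → VF n M,
        covDiff nab (symDiffPow nab j (f ^ (m + (j + 1)))) Y -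
          ((m + (j + 1)).descFactorial (j + 1) : ℝ) • (f ^ m * ∏ i, lieFn (Y i) f)
          ∈ vanishIdeal x ^ (m + 1) := by
      intro Y
      -- With `m + 1` in place of `m`, the error lies in `I ^ (m + 2)`, hence in `I ^ (m + 1)` after
      -- one derivative. Modulo the latter, the connection terms and the derivative of the product
      -- vanish; only the derivative of `f ^ (m + 1)` survives, and its factor `m + 1` completes the
      -- falling factorial.
      have h1 := ih (m + 1) (Fin.tail Y)
      have hm : m + 1 + j = m + (j + 1) := by omega
      have h2 := lieFn_mem (X := Y 0) h1
      rw [sub_eq_add_neg, lieFn_add, ← neg_one_smul ℝ, smul_smul, lieFn_smul, lieFn_mul,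
        lieFn_pow_succ, hm] at h2
      have h3 : ∑ i : Fin j, symDiffPow nab j (f ^ (m + (j + 1)))
          (Function.update (Fin.tail Y) i (nabla nab (Y 0) (Fin.tail Y i)))
          ∈ vanishIdeal x ^ (m + 1) := Ideal.sum_mem _ fun i _ => by
        rw [← hm]; exact symDiffPow_mem nab j (m + 1) (Ideal.pow_mem_pow hf _) _
      have h4 : f ^ (m + 1) * lieFn (Y 0) (∏ i, lieFn (Fin.tail Y i) f)
          ∈ vanishIdeal x ^ (m + 1) := Ideal.mul_mem_right _ _ (Ideal.pow_mem_pow hf _)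
      have h5 : (m + (j + 1)).descFactorial (j + 1) = (m + 1) * (m + (j + 1)).descFactorial j := by
        rw [Nat.descFactorial_succ]; congr 1; omega
      have h6 := Ideal.sub_mem _ (Ideal.add_mem _ h2 (real_smul_mem
        ((m + (j + 1)).descFactorial j : ℝ) h4)) h3
      convert h6 using 1
      rw [h5, Fin.prod_univ_succ]
      simp only [covDiff, Fin.tail, Algebra.smul_def, map_natCast, map_mul, map_neg, map_one,
        Nat.cast_mul]
      ring
    -- The leading product does not depend on the order of the fields, so averaging over
    -- permutations leaves it unchanged.
    have hsum : symDiffPow nab (j + 1) (f ^ (m + (j + 1))) X -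
        ((m + (j + 1)).descFactorial (j + 1) : ℝ) • (f ^ m * ∏ i, lieFn (X i) f) =
        ((Nat.factorial (j + 1) : ℝ)⁻¹) • ∑ p : Equiv.Perm (Fin (j + 1)),
          (covDiff nab (symDiffPow nab j (f ^ (m + (j + 1)))) (X ∘ p) -
          ((m + (j + 1)).descFactorial (j + 1) : ℝ) • (f ^ m * ∏ i, lieFn ((X ∘ p) i) f)) := by
      rw [Finset.sum_sub_distrib, smul_sub]
      congr 1
      have : ∀ p : Equiv.Perm (Fin (j + 1)), ∏ i, lieFn ((X ∘ p) i) f = ∏ i, lieFn (X i) f :=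
        fun p => Equiv.prod_comp p fun i => lieFn (X i) f
      simp only [this]
      rw [Finset.sum_const, Finset.card_univ, Fintype.card_perm, Fintype.card_fin,
        ← Nat.cast_smul_eq_nsmul ℝ, smul_smul, inv_mul_cancel₀ (by positivity), one_smul]
    rw [hsum]
    exact real_smul_mem _ (Ideal.sum_mem _ fun p _ => hterm _)

end Derivations

/-! ### Symbols, quantization and remainders -/

section Symbols

variable {n : ℕ} {M : Type*} [TopologicalSpace M] [ChartedSpace (EuclideanSpace ℝ (Fin n)) M]

/-- `R` kills, at `x`, the functions which vanish at `x` to order `m`. -/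
def KillsAt (x : M) (m : ℕ) (R : Smooth n M →ₗ[ℝ] (M → ℝ)) : Prop :=
  ∀ f ∈ vanishIdeal x ^ m, R f x = 0

theorem prod_mem_vanishIdeal_pow {x : M} {j : ℕ} {f : Fin j → Smooth n M}
    (hf : ∀ i, f i ∈ vanishIdeal x) : ∏ i, f i ∈ vanishIdeal x ^ j := by
  induction j with
  | zero => simp
  | succ j ih =>
    rw [Fin.prod_univ_succ, pow_succ']
    exact Ideal.mul_mem_mul (hf 0) (ih fun i => hf i.succ)

/-- Telescoping: replacing one factor changes the product by an element of `I ^ 2` times `j - 1`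
factors in `I`. Hence degree `j` symbols see only the differentials of the factors. -/
theorem prod_sub_prod_mem {x : M} {j : ℕ} {f g : Fin j → Smooth n M}
    (hf : ∀ i, f i ∈ vanishIdeal x) (hg : ∀ i, g i ∈ vanishIdeal x)
    (hfg : ∀ i, f i - g i ∈ vanishIdeal x ^ 2) :
    ∏ i, f i - ∏ i, g i ∈ vanishIdeal x ^ (j + 1) := by
  induction j with
  | zero => simp
  | succ j ih =>
    rw [Fin.prod_univ_succ, Fin.prod_univ_succ]
    have h1 := Ideal.mul_mem_mul (hf 0)
      (ih (fun i => hf i.succ) (fun i => hg i.succ) fun i => hfg i.succ)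
    have h2 := Ideal.mul_mem_mul (hfg 0) (prod_mem_vanishIdeal_pow fun i => hg i.succ)
    rw [← pow_succ'] at h1
    rw [← pow_add, add_comm 2 j] at h2
    have h3 := Ideal.add_mem _ h1 h2
    convert h3 using 1
    ring

theorem prod_smooth_apply {k : ℕ} (f : Fin k → Smooth n M) (y : M) :
    (∏ i, f i) y = ∏ i, f i y :=
  map_prod (ContMDiffMap.evalRingHom (I := 𝓡 n) (n := ∞) (I' := 𝓘(ℝ, ℝ)) (R := ℝ) y) f _

variable [T2Space M] [IsManifold (𝓡 n) ∞ M]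

theorem smbl_apply (k : ℕ) (R : Smooth n M →ₗ[ℝ] (M → ℝ)) (x : M)
    (θ : Fin k → Cotangent (n := n) x) :
    smbl k R x θ = (Nat.factorial k : ℝ)⁻¹ * R (∏ i, testFn x (θ i)) x := rfl

/-- The symbol of degree `k` may be computed with any functions having the right differentials. -/
theorem smbl_eq {k : ℕ} {R : Smooth n M →ₗ[ℝ] (M → ℝ)} {x : M} (hR : KillsAt x (k + 1) R)
    {f : Fin k → Smooth n M} (hf : ∀ i, f i x = 0) {θ : Fin k → Cotangent (n := n) x}
    (hθ : ∀ i, mvfderiv (𝓡 n) (f i) x = θ i) :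
    smbl k R x θ = (Nat.factorial k : ℝ)⁻¹ * R (∏ i, f i) x := by
  rw [smbl_apply]
  congr 1
  have h := hR _ (prod_sub_prod_mem (f := fun i => testFn x (θ i)) (g := f)
    (fun i => testFn_apply_self x _) hf fun i => mem_vanishIdeal_sq
      (by change testFn x (θ i) x - f i x = 0; rw [testFn_apply_self, hf, sub_zero])
      (by
        have h := mvfderiv_sub (I := 𝓡 n) ((testFn x (θ i)).mdifferentiableAt (x := x))
          ((f i).mdifferentiableAt (x := x))
        rw [mvfderiv_testFn, hθ, sub_self] at h
        exact h))
  rw [map_sub] at h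
  exact sub_eq_zero.mp h

theorem frame_apply_self (x : M) (i : Fin n) :
    frame x i x = (EuclideanSpace.single i (1 : ℝ) : EuclideanSpace ℝ (Fin n)) := by
  have h : ∀ v : TangentSpace (𝓡 n) x,
      bump (n := n) x x • FiberBundle.extend (EuclideanSpace ℝ (Fin n)) v x = v := fun v => by
    rw [FiberBundle.extend_apply_self, (bump_eventually_eq_one (n := n) x).self_of_nhds, one_smul]
  exact h _

theorem cotangent_eq_sum (x : M) (θ : Cotangent (n := n) x) :
    θ = ∑ i, θ (frame x i x) • coframe x i := by
  let θ' : EuclideanSpace ℝ (Fin n) →L[ℝ] ℝ := θ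
  have h : θ' = ∑ i, θ' (EuclideanSpace.single i 1) •
      (EuclideanSpace.proj i : EuclideanSpace ℝ (Fin n) →L[ℝ] ℝ) := by
    ext v
    conv_lhs => rw [show v = ∑ i, v i • EuclideanSpace.single i (1 : ℝ) by
      ext j; simp [Finset.sum_apply, Pi.single_apply], map_sum]
    simp only [map_smul, smul_eq_mul, sum_apply,
      smul_apply]
    exact Finset.sum_congr rfl fun i _ => mul_comm _ _
  simp only [frame_apply_self]
  exact h

theorem multilinear_eq_sum {k : ℕ} {x : M} (H : ContraTensor (n := n) k x)
    (θ : Fin k → Cotangent (n := n) x) :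
    H θ = ∑ J : Fin k → Fin n,
      (∏ m, θ m (frame x (J m) x)) * H fun m => coframe x (J m) := by
  conv_lhs => rw [show θ = fun m => ∑ i, θ m (frame x i x) • coframe x i from
    funext fun m => cotangent_eq_sum x (θ m)]
  rw [MultilinearMap.map_sum]
  exact Finset.sum_congr rfl fun J _ => H.map_smul_univ _ _

variable (nab : AffineConnection n M) [nab.ContMDiffCovariantDerivative ∞]

theorem quantize_apply {k : ℕ} (H : (x : M) → ContraTensor (n := n) k x) (f : Smooth n M) (x : M) :
    quantize nab H f x = ∑ J : Fin k → Fin n,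
      H x (fun m => coframe x (J m)) * symDiffPow nab k f (fun m => frame x (J m)) x := by
  change (Nat.factorial k : ℝ)⁻¹ * ((Nat.factorial k : ℝ) * _) = _
  rw [inv_mul_cancel_left₀ (by positivity)]

theorem quantize_killsAt {k : ℕ} (H : (x : M) → ContraTensor (n := n) k x) (x : M) :
    KillsAt x (k + 1) (quantize nab H) := by
  intro f hf
  rw [quantize_apply]
  refine Finset.sum_eq_zero fun J _ => ?_
  rw [add_comm] at hf
  have := symDiffPow_mem nab k 1 hf fun m => frame x (J m)
  rw [apply_eq_zero_of_mem_pow_succ (m := 0) this, mul_zero]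

/-- The leading-term formula with `m = 0` says that the symbol of `Q(H)` on powers is `H`; the
factor `k!` is the falling factorial, and expansion in the coframe reassembles `H`. -/
theorem quantize_pow {k : ℕ} (H : (x : M) → ContraTensor (n := n) k x) {x : M} {f : Smooth n M}
    (hf : f ∈ vanishIdeal x) :
    quantize nab H (f ^ k) x = (Nat.factorial k : ℝ) * H x fun _ => mvfderiv (𝓡 n) f x := by
  rw [quantize_apply, multilinear_eq_sum, Finset.mul_sum]
  refine Finset.sum_congr rfl fun J _ => ?_
  have h := symDiffPow_pow_sub_mem nab k 0 hf fun m => frame x (J m)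
  have h' := apply_eq_zero_of_mem_pow_succ h
  rw [zero_add, Nat.descFactorial_self, pow_zero, one_mul] at h'
  have h'' : symDiffPow nab k (f ^ k) (fun m => frame x (J m)) x -
    (Nat.factorial k : ℝ) * (∏ i, lieFn (frame x (J i)) f : Smooth n M) x = 0 := h'
  rw [sub_eq_zero.mp h'', prod_smooth_apply]
  simp only [lieFn_apply]
  ring

/-- Subtracting the quantization of its symbol lowers the order of an operator. -/
theorem sub_quantize_smbl_killsAt {j : ℕ} {R : Smooth n M →ₗ[ℝ] (M → ℝ)} {x : M}
    (hR : KillsAt x (j + 1) R) : KillsAt x j (R - quantize nab (smbl j R)) := by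
  let D : Smooth n M →ₗ[ℝ] ℝ := LinearMap.proj x ∘ₗ (R - quantize nab (smbl j R))
  have hD1 : ∀ f ∈ vanishIdeal x ^ (j + 1), D f = 0 := by
    intro f hf
    change R f x - quantize nab (smbl j R) f x = 0
    rw [hR f hf, quantize_killsAt nab _ x f hf, sub_zero]
  have hD2 : ∀ f ∈ vanishIdeal x, D (f ^ j) = 0 := by
    intro f hf
    change R (f ^ j) x - quantize nab (smbl j R) (f ^ j) x = 0
    rw [quantize_pow nab _ hf, smbl_eq hR (f := fun _ => f) (fun _ => hf) (fun _ => rfl),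
      mul_inv_cancel_left₀ (by positivity), Finset.prod_const, Finset.card_univ, Fintype.card_fin,
      sub_self]
  intro f hf
  change D f = 0
  -- Polarization concerns positive powers only. For `j = 0` the ideal power is the whole algebra,
  -- and the constant `f x` is split off instead.
  cases j with
  | zero =>
    have h1 : f = (f - f x • 1) + f x • (f ^ 0) := by rw [pow_zero, sub_add_cancel]
    have h2 : f - f x • 1 ∈ vanishIdeal x ^ (0 + 1) := by
      rw [zero_add, pow_one]
      change f x - f x * 1 = 0
      ring
    have h3 : D 1 = 0 := by simpa using hD2 0 (vanishIdeal x).zero_mem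
    rw [h1, map_add, hD1 _ h2, map_smul, pow_zero, h3, smul_zero, add_zero]
  | succ j => exact eq_zero_of_forall_pow D hD2 hf

/-- Each subtraction of a quantized symbol lowers the order by one. The equation `r + j = k + 1`
bounds `r`, so that the truncated difference `k - r` in `remainder` is a genuine one. -/
theorem remainder_killsAt {k : ℕ} {A : Smooth n M →ₗ[ℝ] Smooth n M} (hA : IsDiffOp k A) (x : M)
    {r j : ℕ} (hrj : r + j = k + 1) : KillsAt x j (remainder nab k A r) := by
  induction r generalizing j with
  | zero =>
    obtain rfl : j = k + 1 := by omega
    exact fun f hf => hA.apply_eq_zero hf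
  | succ r ih =>
    obtain rfl : j = k - r := by omega
    exact sub_quantize_smbl_killsAt nab (ih (by omega))

/-- After `k + 1` steps the remainder kills the zeroth power of every vanishing ideal, which is the
whole algebra. This is the identity `A = ∑ Q(σ_j)`. -/
theorem remainder_succ_self {k : ℕ} {A : Smooth n M →ₗ[ℝ] Smooth n M} (hA : IsDiffOp k A) :
    remainder nab k A (k + 1) = 0 := by
  refine LinearMap.ext fun f => funext fun x => ?_
  exact remainder_killsAt nab hA x (j := 0) rfl f (by simp)

end Symbols

/-! ### Tensoriality of the symmetrised covariant differentials -/

section Tensoriality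

variable {n : ℕ} {M : Type*} [TopologicalSpace M] [ChartedSpace (EuclideanSpace ℝ (Fin n)) M]
  [IsManifold (𝓡 n) ∞ M]

/-- The product of a vector field and a smooth function. -/
def smulVF (f : Smooth n M) (X : VF n M) : VF n M :=
  ⟨fun y => f y • X y, f.contMDiff.smul_section X.contMDiff⟩

theorem smulVF_apply (f : Smooth n M) (X : VF n M) (y : M) : smulVF f X y = f y • X y := rfl

theorem lieFn_add_left (X Y : VF n M) (f : Smooth n M) :
    lieFn (X + Y) f = lieFn X f + lieFn Y f := by
  ext y
  exact map_add (mvfderiv (𝓡 n) f y) (X y) (Y y)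

theorem lieFn_smulVF (g : Smooth n M) (X : VF n M) (f : Smooth n M) :
    lieFn (smulVF g X) f = g * lieFn X f := by
  ext y
  exact map_smul (mvfderiv (𝓡 n) f y) (g y) (X y)

section Nabla

variable (nab : AffineConnection n M) [nab.ContMDiffCovariantDerivative ∞]

theorem nabla_apply (X Y : VF n M) (y : M) : nabla nab X Y y = nab Y y (X y) := rfl

theorem nabla_add_left (X Y Z : VF n M) : nabla nab (X + Y) Z = nabla nab X Z + nabla nab Y Z := by
  ext1 y
  exact map_add (nab Z y) (X y) (Y y)

theorem nabla_smulVF_left (f : Smooth n M) (X Z : VF n M) :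
    nabla nab (smulVF f X) Z = smulVF f (nabla nab X Z) := by
  ext1 y
  exact map_smul (nab Z y) (f y) (X y)

theorem nabla_add_right (X Y Z : VF n M) :
    nabla nab X (Y + Z) = nabla nab X Y + nabla nab X Z := by
  ext1 y
  have h := nab.isCovariantDerivativeOnUniv.add (Y.mdifferentiableAt (x := y))
    (Z.mdifferentiableAt (x := y))
  exact DFunLike.congr_fun h (X y)

theorem nabla_smulVF_right (f : Smooth n M) (X Z : VF n M) :
    nabla nab X (smulVF f Z) = smulVF f (nabla nab X Z) + smulVF (lieFn X f) Z := by
  ext1 y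
  have h := nab.isCovariantDerivativeOnUniv.leibniz (Z.mdifferentiableAt (x := y))
    (f.mdifferentiableAt (x := y))
  exact DFunLike.congr_fun h (X y)

end Nabla

/-- Multilinearity over the smooth functions. -/
structure IsTensorial {k : ℕ} (η : CovField n M k) : Prop where
  add : ∀ X i Y Z, η (Function.update X i (Y + Z)) =
    η (Function.update X i Y) + η (Function.update X i Z)
  smul : ∀ X i f Y, η (Function.update X i (smulVF f Y)) = f * η (Function.update X i Y)

theorem IsTensorial.symmetrize {k : ℕ} {η : CovField n M k} (hη : IsTensorial η) :
    IsTensorial (symmetrize η) where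
  add X i Y Z := by
    simp only [GammaOp.symmetrize, Function.update_comp_equiv, hη.add, Finset.sum_add_distrib,
      smul_add]
  smul X i f Y := by
    simp only [GammaOp.symmetrize, Function.update_comp_equiv, hη.smul, ← Finset.mul_sum,
      mul_smul_comm]

variable (nab : AffineConnection n M) [nab.ContMDiffCovariantDerivative ∞]

theorem covDiff_update_zero {k : ℕ} (η : CovField n M k) (X : Fin (k + 1) → VF n M) (Y : VF n M) :
    covDiff nab η (Function.update X 0 Y) = lieFn Y (η (Fin.tail X)) -
      ∑ i, η (Function.update (Fin.tail X) i (nabla nab Y (Fin.tail X i))) := by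
  simp only [covDiff, Fin.tail_update_zero, Function.update_self]

theorem covDiff_update_succ {k : ℕ} (η : CovField n M k) (X : Fin (k + 1) → VF n M) (l : Fin k)
    (Y : VF n M) :
    covDiff nab η (Function.update X l.succ Y) =
      lieFn (X 0) (η (Function.update (Fin.tail X) l Y)) -
      ∑ i, if i = l then η (Function.update (Fin.tail X) l (nabla nab (X 0) Y))
        else η (Function.update
          (Function.update (Fin.tail X) i (nabla nab (X 0) (Fin.tail X i))) l Y) := by
  simp only [covDiff, Fin.tail_update_succ]
  rw [Function.update_of_ne (Fin.succ_ne_zero l).symm]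
  congr 1
  refine Finset.sum_congr rfl fun i _ => ?_
  split_ifs with h
  · subst h
    rw [Function.update_idem, Function.update_self]
  · rw [Function.update_of_ne h, Function.update_comm h]

/-- In the slot of the direction both terms are linear over functions. In any other slot, the term
with `X_0 f` from differentiating `f * η` cancels the one from `∇_{X_0} (f Y)`. -/
theorem IsTensorial.covDiff {k : ℕ} {η : CovField n M k} (hη : IsTensorial η) :
    IsTensorial (covDiff nab η) where
  add X i Y Z := by
    refine Fin.cases ?_ (fun l => ?_) i
    · simp only [covDiff_update_zero, lieFn_add_left, nabla_add_left, hη.add,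
        Finset.sum_add_distrib]
      abel
    · simp only [covDiff_update_succ, hη.add, lieFn_add, nabla_add_right]
      have h : ∀ (a b c d : Fin k → Smooth n M),
          (∑ i, if i = l then a i + b i else c i + d i) =
            (∑ i, if i = l then a i else c i) + ∑ i, if i = l then b i else d i := by
        intro a b c d
        rw [← Finset.sum_add_distrib]
        exact Finset.sum_congr rfl fun i _ => by split_ifs <;> rfl
      rw [h]
      abel
  smul X i f Y := by
    refine Fin.cases ?_ (fun l => ?_) i
    · simp only [covDiff_update_zero, lieFn_smulVF, nabla_smulVF_left, hη.smul,
        ← Finset.mul_sum, mul_sub]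
    · simp only [covDiff_update_succ, hη.smul, lieFn_mul, nabla_smulVF_right, hη.add]
      have h : ∀ (a b : Smooth n M) (c : Fin k → Smooth n M),
          (∑ i, if i = l then f * a + b else f * c i) =
            f * (∑ i, if i = l then a else c i) + b := by
        intro a b c
        have e : b = ∑ i, if i = l then b else 0 := by simp
        conv_rhs => rw [e, Finset.mul_sum, ← Finset.sum_add_distrib]
        exact Finset.sum_congr rfl fun i _ => by split_ifs <;> simp
      rw [h]
      ring

theorem isTensorial_symDiffPow (k : ℕ) (f : Smooth n M) : IsTensorial (symDiffPow nab k f) := by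
  induction k with
  | zero => exact ⟨fun _ i => i.elim0, fun _ i => i.elim0⟩
  | succ k ih => exact (ih.covDiff nab).symmetrize

end Tensoriality

/-! ### Values of tensor fields at a point -/

section Pointwise

variable {n : ℕ} {M : Type*} [TopologicalSpace M] [ChartedSpace (EuclideanSpace ℝ (Fin n)) M]
  [IsManifold (𝓡 n) ∞ M]

theorem sum_vf_apply {ι : Type*} (s : Finset ι) (X : ι → VF n M) (y : M) :
    (∑ i ∈ s, X i) y = ∑ i ∈ s, X i y := by
  have h := map_sum (ContMDiffSection.coeAddHom (𝓡 n) (EuclideanSpace ℝ (Fin n)) ∞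
    (TangentSpace (𝓡 n) : M → Type)) X s
  have h' := congrFun h y
  rw [Finset.sum_apply] at h'
  exact h'

theorem IsTensorial.zero {k : ℕ} {η : CovField n M k} (hη : IsTensorial η)
    (X : Fin k → VF n M) (i : Fin k) : η (Function.update X i 0) = 0 := by
  have h := hη.add X i 0 0
  rw [add_zero] at h
  exact left_eq_add.mp h

theorem IsTensorial.sum {k : ℕ} {η : CovField n M k} (hη : IsTensorial η) {ι : Type*}
    (X : Fin k → VF n M) (i : Fin k) (s : Finset ι) (Y : ι → VF n M) :
    η (Function.update X i (∑ a ∈ s, Y a)) = ∑ a ∈ s, η (Function.update X i (Y a)) := by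
  classical
  induction s using Finset.induction_on with
  | empty => simpa using hη.zero X i
  | insert a s ha ih => rw [Finset.sum_insert ha, Finset.sum_insert ha, hη.add, ih]

variable [T2Space M]

/-- Near `x`, a vector field vanishing at `x` is a combination, with coefficients vanishing at `x`,
of globally smooth vector fields. -/
theorem exists_coeff_of_apply_eq_zero {x : M} {Y : VF n M} (hY : Y x = 0) :
    ∃ (g : Fin n → Smooth n M) (E : Fin n → VF n M) (b : Smooth n M), b x = 1 ∧
      (∀ i, g i x = 0) ∧ smulVF b Y = ∑ i, smulVF (g i) (E i) := by
  let t := trivializationAt (EuclideanSpace ℝ (Fin n)) (TangentSpace (𝓡 n) : M → Type) x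
  have hx : x ∈ t.baseSet := FiberBundle.mem_baseSet_trivializationAt' x
  let B := (EuclideanSpace.basisFun (Fin n) ℝ).toBasis
  have hE : ∀ i, ∃ E : VF n M, ∀ᶠ y in 𝓝 x, E y = t.localFrame B i y := fun i =>
    exists_vf_germ t.open_baseSet hx (t.contMDiffOn_localFrame_baseSet (I := 𝓡 n) ∞ B i)
  have hg : ∀ i, ∃ g : Smooth n M, ⇑g =ᶠ[𝓝 x]
      fun y => t.localFrameCoeff (𝓡 n) B i y (Y y) := fun i =>
    exists_smooth_germ t.open_baseSet hx
      (contMDiffOn_baseSet_localFrameCoeff B Y.contMDiff.contMDiffOn i)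
  choose E hE using hE
  choose g hg using hg
  have hev : ∀ᶠ y in 𝓝 x, Y y = ∑ i, g i y • E i y := by
    filter_upwards [eventually_all.mpr hE, eventually_all.mpr hg, t.open_baseSet.mem_nhds hx]
      with y hy hy' hyt
    conv_lhs => rw [t.eq_sum_localFrameCoeff_smul (I := 𝓡 n) (b := B) (s := fun y => Y y) hyt]
    exact Finset.sum_congr rfl fun i _ => by rw [hy, hy']
  obtain ⟨b, hb, hbs⟩ := exists_cutoff (n := n) hev
  refine ⟨fun i => b * g i, E, b, hb.self_of_nhds, fun i => ?_, ?_⟩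
  · change b x * g i x = 0
    rw [(hg i).self_of_nhds]
    change b x * t.localFrameCoeff (𝓡 n) B i x (Y x) = 0
    rw [hY, map_zero, mul_zero]
  · ext1 y
    rw [sum_vf_apply, smulVF_apply]
    by_cases hy : b y = 0
    · rw [hy, zero_smul]
      refine (Finset.sum_eq_zero fun i _ => ?_).symm
      change (b y * g i y) • E i y = 0
      rw [hy, zero_mul, zero_smul]
    · have h : Y y = ∑ i, g i y • E i y := hbs (subset_tsupport _ hy)
      rw [h, Finset.smul_sum]
      exact Finset.sum_congr rfl fun i _ => smul_smul _ _ _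

/-- Writing `b Y = ∑ g_a E_a` with `b x = 1` and `g_a x = 0`, linearity over functions expresses the
value at `x` through the `g_a x`. The cutoff `b` replaces any appeal to locality of `η`. -/
theorem IsTensorial.apply_eq_zero {k : ℕ} {η : CovField n M k} (hη : IsTensorial η)
    (X : Fin k → VF n M) (i : Fin k) {Y : VF n M} {x : M} (hY : Y x = 0) :
    η (Function.update X i Y) x = 0 := by
  obtain ⟨g, E, b, hb, hg, h⟩ := exists_coeff_of_apply_eq_zero hY
  have h1 : b x * η (Function.update X i Y) x =
      ∑ a, g a x * η (Function.update X i (E a)) x := by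
    have h2 : (b * η (Function.update X i Y)) x =
        (∑ a, g a * η (Function.update X i (E a)) : Smooth n M) x := by
      rw [← hη.smul, h, hη.sum]
      simp only [hη.smul]
    rw [sum_smooth_apply] at h2
    exact h2
  rw [hb, one_mul] at h1
  rw [h1]
  exact Finset.sum_eq_zero fun a _ => by rw [hg, zero_mul]

theorem IsTensorial.update_congr {k : ℕ} {η : CovField n M k} (hη : IsTensorial η)
    (X : Fin k → VF n M) (i : Fin k) {Y Z : VF n M} {x : M} (hYZ : Y x = Z x) :
    η (Function.update X i Y) x = η (Function.update X i Z) x := by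
  have h := hη.add X i Z (Y - Z)
  rw [add_sub_cancel] at h
  have h1 : η (Function.update X i (Y - Z)) x = 0 :=
    hη.apply_eq_zero X i (by change Y x - Z x = 0; rw [hYZ, sub_self])
  rw [h]
  change η (Function.update X i Z) x + η (Function.update X i (Y - Z)) x = _
  rw [h1, add_zero]

/-- The value of a tensor field at a point depends only on the values of its arguments there. -/
theorem IsTensorial.congr {k : ℕ} {η : CovField n M k} (hη : IsTensorial η)
    {X Y : Fin k → VF n M} {x : M} (hXY : ∀ i, X i x = Y i x) : η X x = η Y x := by
  classical
  -- The arguments are exchanged one at a time, `s` being the set of slots already exchanged.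
  have key : ∀ s : Finset (Fin k), η (fun i => if i ∈ s then Y i else X i) x = η X x := by
    intro s
    induction s using Finset.induction_on with
    | empty => simp
    | insert a s ha ih =>
      rw [← ih]
      have h1 : (fun i => if i ∈ insert a s then Y i else X i) =
          Function.update (fun i => if i ∈ s then Y i else X i) a (Y a) := by
        funext i
        by_cases h : i = a
        · subst h; simp
        · simp [h]
      have h2 : (fun i => if i ∈ s then Y i else X i) =
          Function.update (fun i => if i ∈ s then Y i else X i) a (X a) := by
        funext i
        by_cases h : i = a
        · subst h; simp [ha]
        · simp [h]
      rw [h1]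
      conv_rhs => rw [h2]
      exact hη.update_congr _ a (hXY a).symm
  have := key Finset.univ
  simp only [Finset.mem_univ, if_true] at this
  exact this.symm

/-- The value at `x` of a tensor field, as a multilinear function over `ℝ`. -/
def IsTensorial.atPoint {k : ℕ} {η : CovField n M k} (hη : IsTensorial η) (x : M) :
    MultilinearMap ℝ (fun _ : Fin k => VF n M) ℝ where
  toFun X := η X x
  map_update_add' X i Y Z := by
    -- The structure field quantifies over all decidability instances on `Fin k`, whereas
    -- `IsTensorial` uses the canonical one.
    rename_i inst
    rw [Subsingleton.elim inst (instDecidableEqFin k), hη.add]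
    rfl
  map_update_smul' X i c Y := by
    rename_i inst
    rw [Subsingleton.elim inst (instDecidableEqFin k)]
    have h : c • Y = smulVF (algebraMap ℝ (Smooth n M) c) Y := rfl
    rw [h, hη.smul]
    rfl

end Pointwise

/-! ### Naturality under local diffeomorphisms -/

section Related

variable {n : ℕ} {M : Type*} [TopologicalSpace M] [ChartedSpace (EuclideanSpace ℝ (Fin n)) M]

/-- The germ of `g` at `x` is the pullback along `φ` of the germ of `f` at `φ x`. -/
def FnRel (φ : M → M) (x : M) (g f : Smooth n M) : Prop := ⇑g =ᶠ[𝓝 x] ⇑f ∘ φ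

variable {φ : M → M} {x : M}

theorem FnRel.sub {g g' f f' : Smooth n M} (h : FnRel φ x g f) (h' : FnRel φ x g' f') :
    FnRel φ x (g - g') (f - f') := by
  filter_upwards [h, h'] with y hy hy'
  exact congrArg₂ (· - ·) hy hy'

theorem FnRel.smul {g f : Smooth n M} (c : ℝ) (h : FnRel φ x g f) :
    FnRel φ x (c • g) (c • f) := by
  filter_upwards [h] with y hy
  exact congrArg (c • ·) hy

theorem FnRel.sum {ι : Type*} (s : Finset ι) {g f : ι → Smooth n M}
    (h : ∀ i, FnRel φ x (g i) (f i)) : FnRel φ x (∑ i ∈ s, g i) (∑ i ∈ s, f i) := by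
  filter_upwards [(s.eventually_all (l := 𝓝 x)).mpr fun i _ => h i] with y hy
  rw [Function.comp_apply, sum_smooth_apply, sum_smooth_apply]
  exact Finset.sum_congr rfl hy

theorem FnRel.prod {k : ℕ} {g f : Fin k → Smooth n M} (h : ∀ i, FnRel φ x (g i) (f i)) :
    FnRel φ x (∏ i, g i) (∏ i, f i) := by
  filter_upwards [eventually_all.mpr h] with y hy
  rw [Function.comp_apply, prod_smooth_apply, prod_smooth_apply]
  exact Finset.prod_congr rfl fun i _ => hy i

variable [IsManifold (𝓡 n) ∞ M]

/-- The vector fields `X` and `X'` are `φ`-related near `x`. -/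
def VFRel (φ : M → M) (x : M) (X X' : VF n M) : Prop :=
  ∀ᶠ y in 𝓝 x, mfderiv (𝓡 n) (𝓡 n) φ y (X y) = X' (φ y)

theorem FnRel.mvfderiv_apply {g f : Smooth n M} (h : FnRel φ x g f)
    (hφ : MDifferentiableAt (𝓡 n) (𝓡 n) φ x) (v : TangentSpace (𝓡 n) x) :
    mvfderiv (𝓡 n) g x v = mvfderiv (𝓡 n) f (φ x) (mfderiv (𝓡 n) (𝓡 n) φ x v) := by
  rw [← mvfderiv_comp_apply x f.mdifferentiableAt hφ]
  have h1 : mfderiv (𝓡 n) 𝓘(ℝ, ℝ) g x = mfderiv (𝓡 n) 𝓘(ℝ, ℝ) (f ∘ φ) x :=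
    Filter.EventuallyEq.mfderiv_eq h
  exact DFunLike.congr_fun h1 v

theorem FnRel.lieFn {g f : Smooth n M} {X X' : VF n M} (h : FnRel φ x g f) (hX : VFRel φ x X X')
    (hφ : ∀ᶠ y in 𝓝 x, MDifferentiableAt (𝓡 n) (𝓡 n) φ y) :
    FnRel φ x (lieFn X g) (lieFn X' f) := by
  filter_upwards [eventually_eventually_nhds.mpr h, hX, hφ] with y hy hXy hφy
  rw [Function.comp_apply, lieFn_apply, lieFn_apply, FnRel.mvfderiv_apply (φ := φ) hy hφy, hXy]

/-- `φ` carries the connection `nab₁` to `nab₂` near `x`. -/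
def ConnRel (φ : M → M) (x : M) (nab₁ nab₂ : AffineConnection n M) : Prop :=
  ∀ᶠ y in 𝓝 x, ∀ Y Y' : VF n M, VFRel φ y Y Y' → ∀ w : TangentSpace (𝓡 n) y,
    mfderiv (𝓡 n) (𝓡 n) φ y (nab₁ Y y w) = nab₂ Y' (φ y) (mfderiv (𝓡 n) (𝓡 n) φ y w)

variable {nab₁ nab₂ : AffineConnection n M} [nab₁.ContMDiffCovariantDerivative ∞]
  [nab₂.ContMDiffCovariantDerivative ∞]

theorem VFRel.nabla (hn : ConnRel φ x nab₁ nab₂) {X X' Y Y' : VF n M} (hX : VFRel φ x X X')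
    (hY : VFRel φ x Y Y') : VFRel φ x (nabla nab₁ X Y) (nabla nab₂ X' Y') := by
  filter_upwards [hn, hX, eventually_eventually_nhds.mpr hY] with y hny hXy hYy
  rw [nabla_apply, nabla_apply, hny Y Y' hYy, hXy]

/-- Derivatives along fields, `∇` and permutations all respect relatedness. The induction needs
relatedness on a neighbourhood, not just at `x`, because each step differentiates the previous one.
-/
theorem FnRel.symDiffPow (hn : ConnRel φ x nab₁ nab₂)
    (hφ : ∀ᶠ y in 𝓝 x, MDifferentiableAt (𝓡 n) (𝓡 n) φ y) (k : ℕ) {g f : Smooth n M}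
    (h : FnRel φ x g f) {X X' : Fin k → VF n M} (hX : ∀ i, VFRel φ x (X i) (X' i)) :
    FnRel φ x (symDiffPow nab₁ k g X) (symDiffPow nab₂ k f X') := by
  induction k with
  | zero => exact h
  | succ k ih =>
    refine FnRel.smul _ (FnRel.sum _ fun p => ?_)
    have hXp : ∀ i, VFRel φ x ((X ∘ p) i) ((X' ∘ p) i) := fun i => hX (p i)
    refine FnRel.sub (FnRel.lieFn (ih fun i => hXp i.succ) (hXp 0) hφ)
      (FnRel.sum _ fun i => ih fun l => ?_)
    by_cases hl : l = i
    · subst hl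
      rw [Function.update_self, Function.update_self]
      exact VFRel.nabla hn (hXp 0) (hXp l.succ)
    · rw [Function.update_of_ne hl, Function.update_of_ne hl]
      exact hXp l.succ

end Related

/-! ### Naturality of symbols and of quantization -/

section Naturality

variable {n : ℕ} {M : Type*} [TopologicalSpace M] [ChartedSpace (EuclideanSpace ℝ (Fin n)) M]
  [IsManifold (𝓡 n) ∞ M]

/-- `φ` is a smooth diffeomorphism between open subsets of `M`. -/
structure IsLocalDiffeo (φ : OpenPartialHomeomorph M M) : Prop where
  smooth : ContMDiffOn (𝓡 n) (𝓡 n) ∞ φ φ.source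
  smooth_symm : ContMDiffOn (𝓡 n) (𝓡 n) ∞ φ.symm φ.target

variable {φ : OpenPartialHomeomorph M M} {x : M}

namespace IsLocalDiffeo

variable (hφ : IsLocalDiffeo (n := n) φ) (hx : x ∈ φ.source)
include hφ hx

theorem contMDiffAt : ContMDiffAt (𝓡 n) (𝓡 n) ∞ φ x :=
  (hφ.smooth x hx).contMDiffAt (φ.open_source.mem_nhds hx)

theorem mdifferentiableAt : MDifferentiableAt (𝓡 n) (𝓡 n) φ x :=
  (hφ.contMDiffAt hx).mdifferentiableAt (by simp)

theorem eventually_mdifferentiableAt : ∀ᶠ y in 𝓝 x, MDifferentiableAt (𝓡 n) (𝓡 n) φ y :=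
  eventually_of_mem (φ.open_source.mem_nhds hx) fun _ hy => hφ.mdifferentiableAt hy

theorem exists_equiv : ∃ e : TangentSpace (𝓡 n) x ≃L[ℝ] TangentSpace (𝓡 n) (φ x),
    mfderiv (𝓡 n) (𝓡 n) φ x = e := by
  have h : φ.MDifferentiable (𝓡 n) (𝓡 n) :=
    ⟨hφ.smooth.mdifferentiableOn (by simp), hφ.smooth_symm.mdifferentiableOn (by simp)⟩
  exact ⟨h.mfderiv hx, rfl⟩

theorem isInvertible : (mfderiv (𝓡 n) (𝓡 n) φ x).IsInvertible := by
  obtain ⟨e, he⟩ := hφ.exists_equiv hx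
  exact ⟨e, he.symm⟩

theorem mfderiv_injective : Function.Injective (mfderiv (𝓡 n) (𝓡 n) φ x) := by
  obtain ⟨e, he⟩ := hφ.exists_equiv hx
  rw [he]
  exact e.injective

variable [T2Space M]

theorem exists_fnRel (f : Smooth n M) : ∃ g : Smooth n M, FnRel φ x g f :=
  exists_smooth_germ φ.open_source hx (f.contMDiff.comp_contMDiffOn hφ.smooth)

theorem exists_vfRel (X' : VF n M) : ∃ X : VF n M, VFRel φ x X X' := by
  obtain ⟨X, hX⟩ := exists_vf_germ (n := n)
    (X := VectorField.mpullback (𝓡 n) (𝓡 n) φ fun y => X' y) φ.open_source hx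
    fun y hy => (ContMDiffAt.mpullback_vectorField_preimage (n := ∞) (m := ∞)
      (X'.contMDiff (φ y)) (hφ.contMDiffAt hy) (hφ.isInvertible hy) (by simp)).contMDiffWithinAt
  refine ⟨X, ?_⟩
  filter_upwards [hX, φ.open_source.mem_nhds hx] with y hy hys
  rw [hy, VectorField.mpullback_apply]
  exact (hφ.isInvertible hys).self_apply_inverse _

end IsLocalDiffeo

theorem pushTensor_apply {k : ℕ} {a b : M} (L : TangentSpace (𝓡 n) a →L[ℝ] TangentSpace (𝓡 n) b)
    (σ : ContraTensor (n := n) k a) (θ : Fin k → Cotangent (n := n) b) :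
    pushTensor L σ θ = σ fun i => (θ i).comp L := rfl

variable [T2Space M]

/-- The symbol is natural. -/
theorem smbl_natural (hφ : IsLocalDiffeo (n := n) φ) (hx : x ∈ φ.source) {k : ℕ}
    {R₁ R₂ : Smooth n M →ₗ[ℝ] (M → ℝ)} (hR₁ : KillsAt x (k + 1) R₁)
    (hR : ∀ g f : Smooth n M, FnRel φ x g f → R₁ g x = R₂ f (φ x)) :
    pushTensor (mfderiv (𝓡 n) (𝓡 n) φ x) (smbl k R₁ x) = smbl k R₂ (φ x) := by
  ext θ
  -- The pullbacks of the test functions at `φ x` are not the test functions at `x`, but they have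
  -- the right differentials, which suffices by `smbl_eq`.
  choose g hg using fun i => hφ.exists_fnRel hx (testFn (φ x) (θ i))
  rw [pushTensor_apply, smbl_eq hR₁ (f := g), hR _ _ (FnRel.prod hg), smbl_apply]
  · intro i
    rw [(hg i).self_of_nhds, Function.comp_apply, testFn_apply_self]
  · intro i
    refine ContinuousLinearMap.ext fun v => ?_
    rw [FnRel.mvfderiv_apply (hg i) (hφ.mdifferentiableAt hx), mvfderiv_testFn]
    rfl

theorem tangent_eq_sum (x : M) (v : TangentSpace (𝓡 n) x) :
    v = ∑ i, coframe x i v • frame x i x := by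
  let v' : EuclideanSpace ℝ (Fin n) := v
  have h : v' = ∑ i, v' i • (EuclideanSpace.single i (1 : ℝ) : EuclideanSpace ℝ (Fin n)) := by
    ext j; simp [Finset.sum_apply, Pi.single_apply]
  simp only [frame_apply_self]
  exact h

variable {nab₁ nab₂ : AffineConnection n M} [nab₁.ContMDiffCovariantDerivative ∞]
  [nab₂.ContMDiffCovariantDerivative ∞]

/-- Quantization is natural. -/
theorem quantize_natural (hφ : IsLocalDiffeo (n := n) φ) (hx : x ∈ φ.source)
    (hn : ConnRel φ x nab₁ nab₂) {k : ℕ} {H₁ H₂ : (y : M) → ContraTensor (n := n) k y}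
    (hH : pushTensor (mfderiv (𝓡 n) (𝓡 n) φ x) (H₁ x) = H₂ (φ x)) {g f : Smooth n M}
    (hgf : FnRel φ x g f) : quantize nab₁ H₁ g x = quantize nab₂ H₂ f (φ x) := by
  -- The chart frames at `x` and `φ x` need not correspond. The frame at `φ x` is pulled back to the
  -- fields `X i`, in which the frame at `x` is then expanded at `x`; tensoriality makes the value
  -- there sufficient.
  choose X hX using fun i => hφ.exists_vfRel hx (frame (n := n) (φ x) i)
  let T := (isTensorial_symDiffPow nab₁ k g).atPoint x
  have hT : ∀ Y, T Y = symDiffPow nab₁ k g Y x := fun _ => rfl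
  set D := mfderiv (𝓡 n) (𝓡 n) φ x with hD
  have hη : ∀ J : Fin k → Fin n, symDiffPow nab₂ k f (fun m => frame (φ x) (J m)) (φ x) =
      T fun m => X (J m) := fun J =>
    ((FnRel.symDiffPow hn (hφ.eventually_mdifferentiableAt hx) k hgf
      fun i => hX (J i)).self_of_nhds).symm
  have hsum : ∀ l, (∑ i, coframe (φ x) i (D (frame x l x)) • X i) x = frame x l x := by
    intro l
    apply hφ.mfderiv_injective hx
    rw [sum_vf_apply, map_sum]
    conv_rhs => rw [tangent_eq_sum (φ x) (D (frame x l x))]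
    refine Finset.sum_congr rfl fun i _ => ?_
    rw [← (hX i).self_of_nhds]
    exact map_smul D _ _
  have hK : ∀ K : Fin k → Fin n, symDiffPow nab₁ k g (fun m => frame x (K m)) x =
      ∑ J : Fin k → Fin n, (∏ m, coframe (φ x) (J m) (D (frame x (K m) x))) *
        T fun m => X (J m) := by
    intro K
    rw [(isTensorial_symDiffPow nab₁ k g).congr (x := x) fun m => (hsum (K m)).symm, ← hT,
      MultilinearMap.map_sum]
    exact Finset.sum_congr rfl fun J _ => T.map_smul_univ _ _
  rw [quantize_apply, quantize_apply, ← hH]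
  simp only [hη, hK, pushTensor_apply]
  simp only [Finset.mul_sum]
  rw [Finset.sum_comm]
  refine Finset.sum_congr rfl fun J _ => ?_
  rw [multilinear_eq_sum (H₁ x), Finset.sum_mul]
  refine Finset.sum_congr rfl fun K _ => ?_
  simp only [ContinuousLinearMap.comp_apply]
  ring

end Naturality

/-! ### Parallel transport and covariant derivatives -/

section Coordinates

variable {n : ℕ} {M : Type*} [TopologicalSpace M] [ChartedSpace (EuclideanSpace ℝ (Fin n)) M]
  [IsManifold (𝓡 n) ∞ M]

/-- The coordinates of tangent vectors at `y` in the trivialization of the tangent bundle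
at `x`. -/
def coord (x y : M) : TangentSpace (𝓡 n) y →L[ℝ] EuclideanSpace ℝ (Fin n) :=
  fderivWithin ℝ ((chartAt (EuclideanSpace ℝ (Fin n)) x).extend (𝓡 n) ∘
    ((chartAt (EuclideanSpace ℝ (Fin n)) y).extend (𝓡 n)).symm) (range (𝓡 n))
    ((chartAt (EuclideanSpace ℝ (Fin n)) y).extend (𝓡 n) y)

theorem coord_apply (x y : M) (v : TangentSpace (𝓡 n) y) :
    coord x y v = (trivializationAt (EuclideanSpace ℝ (Fin n))
      (TangentSpace (𝓡 n) : M → Type) x ⟨y, v⟩).2 := rfl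

/-- The identification of the tangent space at `x` with the model space by means of the chart
at `x`. -/
def toModel (x : M) : TangentSpace (𝓡 n) x →L[ℝ] EuclideanSpace ℝ (Fin n) :=
  ContinuousLinearMap.id ℝ (EuclideanSpace ℝ (Fin n))

theorem coord_self (x : M) (v : TangentSpace (𝓡 n) x) : coord x x v = toModel x v :=
  tangentCoordChange_self (I := 𝓡 n) (x := x) (z := x) (mem_extChartAt_source x)

theorem coord_extend {x : M} (v : TangentSpace (𝓡 n) x) :
    ∀ᶠ y in 𝓝 x, coord x y (FiberBundle.extend (EuclideanSpace ℝ (Fin n)) v y) =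
      toModel x v := by
  let t := trivializationAt (EuclideanSpace ℝ (Fin n)) (TangentSpace (𝓡 n) : M → Type) x
  have hx : x ∈ t.baseSet := FiberBundle.mem_baseSet_trivializationAt' x
  filter_upwards [t.open_baseSet.mem_nhds hx] with y hy
  rw [coord_apply]
  have h : (t ⟨y, t.symm y (t ⟨x, v⟩).2⟩).2 = (t ⟨x, v⟩).2 := by rw [t.apply_mk_symm hy]
  exact h.trans (coord_self x v)

theorem mdifferentiableAt_coord {x : M} {Y : (y : M) → TangentSpace (𝓡 n) y}
    (hY : MDifferentiableAt (𝓡 n) (𝓡 n).tangent (fun y => (⟨y, Y y⟩ : TangentBundle (𝓡 n) M)) x) :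
    MDifferentiableAt (𝓡 n) 𝓘(ℝ, EuclideanSpace ℝ (Fin n)) (fun y => coord x y (Y y)) x :=
  (mdifferentiableAt_section (IB := 𝓡 n) (F := EuclideanSpace ℝ (Fin n))
    (E := (TangentSpace (𝓡 n) : M → Type)) Y).mp hY

/-- The covariant derivative in the trivialization of the tangent bundle. -/
theorem covariantDerivative_eq (nab : AffineConnection n M) {x : M}
    {Y : (y : M) → TangentSpace (𝓡 n) y}
    (hY : MDifferentiableAt (𝓡 n) (𝓡 n).tangent (fun y => (⟨y, Y y⟩ : TangentBundle (𝓡 n) M)) x)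
    (w : TangentSpace (𝓡 n) x) :
    toModel x (nab Y x w) = mvfderiv (𝓡 n) (fun y => coord x y (Y y)) x w +
      toModel x (nab (FiberBundle.extend (EuclideanSpace ℝ (Fin n)) (Y x)) x w) := by
  -- The difference between `∇_w` and the coordinate derivative is tensorial, so `Y` may be replaced
  -- by the field with constant coefficients through `Y x`, whose coordinate derivative is zero.
  let Φ : ((y : M) → TangentSpace (𝓡 n) y) → EuclideanSpace ℝ (Fin n) := fun σ =>
    toModel x (nab σ x w) - mvfderiv (𝓡 n) (fun y => coord x y (σ y)) x w
  have hΦ : TensorialAt (𝓡 n) (EuclideanSpace ℝ (Fin n)) Φ x := by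
    refine ⟨fun {f σ} hf hσ => ?_, fun {σ σ'} hσ hσ' => ?_⟩
    · have h1 := congrArg (toModel x)
        (DFunLike.congr_fun (nab.isCovariantDerivativeOnUniv.leibniz hσ hf) w)
      have h2 : (fun y => coord x y ((f • σ) y)) = f • fun y => coord x y (σ y) := by
        funext y
        exact map_smul (coord x y) (f y) (σ y)
      have h3 := DFunLike.congr_fun (mvfderiv_smul hf (mdifferentiableAt_coord hσ)) w
      simp only [add_apply, smul_apply, ContinuousLinearMap.smulRight_apply, map_add,
        map_smul, coord_self] at h1 h3
      simp only [Φ, h2]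
      rw [h1, h3]
      module
    · have h1 := congrArg (toModel x)
        (DFunLike.congr_fun (nab.isCovariantDerivativeOnUniv.add hσ hσ') w)
      have h2 : (fun y => coord x y ((σ + σ') y)) =
          (fun y => coord x y (σ y)) + fun y => coord x y (σ' y) := by
        funext y
        exact map_add (coord x y) (σ y) (σ' y)
      have h3 := DFunLike.congr_fun
        (mvfderiv_add (mdifferentiableAt_coord hσ) (mdifferentiableAt_coord hσ')) w
      simp only [add_apply, map_add] at h1 h3
      simp only [Φ, h2]
      rw [h1, h3]
      abel
  have h := hΦ.pointwise hY
    (FiberBundle.mdifferentiableAt_extend (𝓡 n) (EuclideanSpace ℝ (Fin n)) (Y x))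
    (FiberBundle.extend_apply_self (F := EuclideanSpace ℝ (Fin n)) (Y x)).symm
  have h0 : mvfderiv (𝓡 n) (fun y => coord x y
      (FiberBundle.extend (EuclideanSpace ℝ (Fin n)) (Y x) y)) x w = 0 := by
    have h1 : (fun y => coord x y (FiberBundle.extend (EuclideanSpace ℝ (Fin n)) (Y x) y))
        =ᶠ[𝓝 x] fun _ => toModel x (Y x) := coord_extend (Y x)
    have h2 := h1.mfderiv_eq (I := 𝓡 n) (I' := 𝓘(ℝ, EuclideanSpace ℝ (Fin n)))
    have h3 : mfderiv (𝓡 n) 𝓘(ℝ, EuclideanSpace ℝ (Fin n)) (fun _ : M => toModel x (Y x)) x = 0 :=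
      mfderiv_const
    exact DFunLike.congr_fun (h2.trans h3) w
  simp only [Φ] at h
  rw [h0, sub_zero, sub_eq_iff_eq_add'] at h
  exact h

end Coordinates

/-! ### Recovering the connection from its parallel transport -/

section Transport

variable {n : ℕ} {M : Type*} [TopologicalSpace M] [ChartedSpace (EuclideanSpace ℝ (Fin n)) M]
  [IsManifold (𝓡 n) ∞ M]

theorem hasDerivAt_inverse {E : Type*} [NormedAddCommGroup E] [NormedSpace ℝ E] [CompleteSpace E]
    {p : ℝ → E →L[ℝ] E} {K : E →L[ℝ] E} {t : ℝ} (hp : p t = 1) (hK : HasDerivAt p K t) :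
    HasDerivAt (fun s => Ring.inverse (p s)) (-K) t := by
  have h := hasFDerivAt_ringInverse (𝕜 := ℝ) (1 : (E →L[ℝ] E)ˣ)
  rw [Units.val_one, ← hp] at h
  simpa [Function.comp_def] using h.comp_hasDerivAt t hK

/-- The velocity of a curve. -/
def velocity (γ : ℝ → M) (t : ℝ) : TangentSpace (𝓡 n) (γ t) :=
  mfderiv 𝓘(ℝ, ℝ) (𝓡 n) γ t (1 : ℝ)

variable {nab : AffineConnection n M} {γ : ℝ → M}
  {P : (t : ℝ) → TangentSpace (𝓡 n) (γ 0) →L[ℝ] TangentSpace (𝓡 n) (γ t)}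

theorem hasDerivAt_coord_comp (hγ : MDifferentiableAt 𝓘(ℝ, ℝ) (𝓡 n) γ 0)
    {Y : (y : M) → TangentSpace (𝓡 n) y}
    (hY : MDifferentiableAt (𝓡 n) (𝓡 n).tangent
      (fun y => (⟨y, Y y⟩ : TangentBundle (𝓡 n) M)) (γ 0)) :
    HasDerivAt (fun s => coord (γ 0) (γ s) (Y (γ s)))
      (toModel _ (nab Y (γ 0) (velocity γ 0)) - toModel _
        (nab (FiberBundle.extend (EuclideanSpace ℝ (Fin n)) (Y (γ 0))) (γ 0) (velocity γ 0))) 0 := by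
  have h1 : HasFDerivAt _ (_ : ℝ →L[ℝ] EuclideanSpace ℝ (Fin n)) (0 : ℝ) :=
    ((mdifferentiableAt_coord hY).hasMFDerivAt.comp 0 hγ.hasMFDerivAt).hasFDerivAt
  have h2 := h1.hasDerivAt
  have h3 := covariantDerivative_eq nab hY (velocity γ 0)
  rw [h3, add_sub_cancel_right]
  exact h2

theorem IsParallelTransport.hasDerivAt (hP : IsParallelTransport nab γ P)
    (v : TangentSpace (𝓡 n) (γ 0)) :
    HasDerivAt (fun s => coord (γ 0) (γ s) (P s v))
      (-toModel _ (nab (FiberBundle.extend (EuclideanSpace ℝ (Fin n)) v) (γ 0) (velocity γ 0)))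
      0 := by
  have h := hP.2 v 0
  have h0 : (fun t => P t v) 0 = v := by change P 0 v = v; rw [hP.1]; rfl
  rw [h0] at h
  exact h

/-- The covariant derivative is the derivative of the field moved back to the starting point by
parallel transport. -/
theorem IsParallelTransport.hasDerivAt_of_apply_eq (hP : IsParallelTransport nab γ P)
    (hγ : MDifferentiableAt 𝓘(ℝ, ℝ) (𝓡 n) γ 0) {Y : (y : M) → TangentSpace (𝓡 n) y}
    (hY : MDifferentiableAt (𝓡 n) (𝓡 n).tangent
      (fun y => (⟨y, Y y⟩ : TangentBundle (𝓡 n) M)) (γ 0))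
    {u : ℝ → TangentSpace (𝓡 n) (γ 0)} (hu : ∀ᶠ s in 𝓝 0, P s (u s) = Y (γ s)) :
    HasDerivAt (fun s => toModel _ (u s)) (toModel _ (nab Y (γ 0) (velocity γ 0))) 0 := by
  let E := EuclideanSpace ℝ (Fin n)
  let p : ℝ → E →L[ℝ] E := fun s => (coord (γ 0) (γ s)).comp (P s)
  let Γ : TangentSpace (𝓡 n) (γ 0) → E := fun v =>
    toModel _ (nab (FiberBundle.extend E v) (γ 0) (velocity γ 0))
  have hpv : ∀ v : E, HasDerivAt (fun s => p s v) (-Γ v) 0 := fun v => hP.hasDerivAt v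
  have hp0 : p 0 = 1 := by
    refine ContinuousLinearMap.ext fun v => ?_
    change coord (γ 0) (γ 0) (P 0 v) = v
    rw [hP.1]
    exact coord_self _ _
  -- Parallelism differentiates `p s v` for each fixed `v`; expansion in a finite basis makes `p`
  -- itself differentiable as an operator-valued curve.
  obtain ⟨K, hK⟩ : ∃ K : E →L[ℝ] E, HasDerivAt p K 0 := by
    have hp : p = fun s => ∑ i, (EuclideanSpace.proj i : E →L[ℝ] ℝ).smulRight
        (p s (EuclideanSpace.single i 1)) := by
      funext s
      refine ContinuousLinearMap.ext fun v => ?_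
      conv_lhs => rw [show v = ∑ i, v i • EuclideanSpace.single i (1 : ℝ) by
        ext j; simp [Finset.sum_apply, Pi.single_apply], map_sum]
      simp only [map_smul, sum_apply, ContinuousLinearMap.smulRight_apply]
      rfl
    rw [hp]
    exact ⟨_, HasDerivAt.fun_sum fun i _ =>
      ((ContinuousLinearMap.smulRightL ℝ E E (EuclideanSpace.proj i)).hasFDerivAt.comp_hasDerivAt 0
        (hpv (EuclideanSpace.single i 1)))⟩
  have hKv : ∀ v, K v = -Γ v := fun v =>
    (hK.clm_apply (hasDerivAt_const 0 v)).unique (by simpa using hpv v) |> fun h => by simpa using h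
  have hy := hasDerivAt_coord_comp (nab := nab) hγ hY
  have hinv : HasDerivAt (fun s => Ring.inverse (p s)) (-K) 0 := hasDerivAt_inverse hp0 hK
  have hunit : ∀ᶠ s in 𝓝 0, IsUnit (p s) := by
    have h1 := hK.continuousAt
    refine h1.eventually (Units.isOpen.mem_nhds ?_)
    rw [hp0]; exact isUnit_one
  have hu' : (fun s => toModel _ (u s)) =ᶠ[𝓝 0] fun s => Ring.inverse (p s) (coord (γ 0) (γ s) (Y (γ s))) := by
    filter_upwards [hunit, hu] with s hs hus
    have h1 : p s (toModel _ (u s)) = coord (γ 0) (γ s) (Y (γ s)) := by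
      change coord (γ 0) (γ s) (P s (u s)) = _
      rw [hus]
    rw [← h1]
    change toModel _ (u s) = (Ring.inverse (p s) * p s) (toModel _ (u s))
    rw [Ring.inverse_mul_cancel _ hs]
    rfl
  have hfin := (hinv.clm_apply hy).congr_of_eventuallyEq hu'
  -- In the product rule for `p⁻¹` applied to the coordinates of `Y`, the term `-K (Y) = Γ (Y)`
  -- cancels the connection term and leaves `∇ Y`.
  have hval : (-K) (coord (γ 0) (γ 0) (Y (γ 0))) + (Ring.inverse (p 0))
      (toModel _ (nab Y (γ 0) (velocity γ 0)) -
        toModel _ (nab (FiberBundle.extend E (Y (γ 0))) (γ 0) (velocity γ 0))) =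
      toModel _ (nab Y (γ 0) (velocity γ 0)) := by
    rw [hp0, Ring.inverse_one, coord_self]
    change -K (toModel _ (Y (γ 0))) + (_ - _) = _
    rw [hKv]
    change - -toModel _ (nab (FiberBundle.extend E (Y (γ 0))) (γ 0) (velocity γ 0)) + _ = _
    abel
  rw [← hval]
  exact hfin

end Transport

/-! ### Differentials of elements of a pseudogroup -/

section Jets

variable {n : ℕ} {M : Type*} [TopologicalSpace M] [ChartedSpace (EuclideanSpace ℝ (Fin n)) M]
  [IsManifold (𝓡 n) ∞ M] {Γ : StructureGroupoid M}

theorem IsSmoothPseudogroup.isLocalDiffeo (hΓ : IsSmoothPseudogroup (n := n) Γ)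
    {φ : OpenPartialHomeomorph M M} (hφ : φ ∈ Γ) : IsLocalDiffeo (n := n) φ :=
  ⟨hΓ.smooth φ hφ, hΓ.smooth φ.symm (Γ.symm hφ)⟩

theorem mfderiv_mem_jets {φ : OpenPartialHomeomorph M M} (hφ : φ ∈ Γ) {x : M}
    (hx : x ∈ φ.source) : mfderiv (𝓡 n) (𝓡 n) φ x ∈ jets Γ x (φ x) :=
  ⟨φ, hφ, hx, rfl, rfl⟩

theorem comp_mem_jets (hΓ : IsSmoothPseudogroup (n := n) Γ) {a b c : M}
    {L : TangentSpace (𝓡 n) a →L[ℝ] TangentSpace (𝓡 n) b}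
    {L' : TangentSpace (𝓡 n) b →L[ℝ] TangentSpace (𝓡 n) c}
    (hL' : L' ∈ jets Γ b c) (hL : L ∈ jets Γ a b) : L'.comp L ∈ jets Γ a c := by
  obtain ⟨φ, hφ, ha, rfl, rfl⟩ := hL
  obtain ⟨ψ, hψ, hb, rfl, rfl⟩ := hL'
  refine ⟨φ.trans ψ, Γ.trans hφ hψ, by simp [ha, hb], rfl, ?_⟩
  exact mfderiv_comp a ((hΓ.isLocalDiffeo hψ).mdifferentiableAt hb)
    ((hΓ.isLocalDiffeo hφ).mdifferentiableAt ha)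

theorem exists_inverse_mem_jets (hΓ : IsSmoothPseudogroup (n := n) Γ) {a b : M}
    {L : TangentSpace (𝓡 n) a →L[ℝ] TangentSpace (𝓡 n) b} (hL : L ∈ jets Γ a b) :
    ∃ L' ∈ jets Γ b a, (∀ v, L' (L v) = v) ∧ ∀ v, L (L' v) = v := by
  obtain ⟨φ, hφ, ha, rfl, rfl⟩ := hL
  have h : φ.MDifferentiable (𝓡 n) (𝓡 n) :=
    ⟨(hΓ.isLocalDiffeo hφ).smooth.mdifferentiableOn (by simp),
      (hΓ.isLocalDiffeo hφ).smooth_symm.mdifferentiableOn (by simp)⟩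
  refine ⟨(h.mfderiv ha).symm, ⟨φ.symm, Γ.symm hφ, φ.map_source ha, φ.left_inv ha, rfl⟩,
    fun v => ?_, fun v => ?_⟩
  · exact (h.mfderiv ha).symm_apply_apply v
  · exact (h.mfderiv ha).apply_symm_apply v

theorem pushTensor_comp {k : ℕ} {a b c : M}
    (L : TangentSpace (𝓡 n) a →L[ℝ] TangentSpace (𝓡 n) b)
    (L' : TangentSpace (𝓡 n) b →L[ℝ] TangentSpace (𝓡 n) c) (σ : ContraTensor (n := n) k a) :
    pushTensor (L'.comp L) σ = pushTensor L' (pushTensor L σ) := rfl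

theorem pushTensor_eq_of_leftInverse {k : ℕ} {a b : M}
    {L : TangentSpace (𝓡 n) a →L[ℝ] TangentSpace (𝓡 n) b}
    {L' : TangentSpace (𝓡 n) b →L[ℝ] TangentSpace (𝓡 n) a} (h : ∀ v, L' (L v) = v)
    {σ : ContraTensor (n := n) k a} {τ : ContraTensor (n := n) k b} (hσ : pushTensor L σ = τ) :
    pushTensor L' τ = σ := by
  rw [← hσ, ← pushTensor_comp]
  have : L'.comp L = ContinuousLinearMap.id ℝ _ := ContinuousLinearMap.ext h
  rw [this]
  rfl

end Jets

/-! ### Smooth curves with prescribed velocity -/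

section Curves

variable {n : ℕ} {M : Type*} [TopologicalSpace M] [ChartedSpace (EuclideanSpace ℝ (Fin n)) M]
  [IsManifold (𝓡 n) ∞ M]

/-- Each tangent vector is the velocity of a smooth curve defined for all times and contained in
a given neighbourhood. -/
theorem exists_curve {U : Set M} (hU : IsOpen U) {x : M} (hx : x ∈ U)
    (w : EuclideanSpace ℝ (Fin n)) :
    ∃ γ : ℝ → M, ContMDiff 𝓘(ℝ, ℝ) (𝓡 n) ∞ γ ∧ γ 0 = x ∧ (∀ t, γ t ∈ U) ∧
      toModel _ (velocity γ 0) = w := by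
  set e := extChartAt (𝓡 n) x with he
  set c := e x with hc
  have hex : e.symm c = x := extChartAt_to_inv x
  have hcont : ContinuousAt e.symm c := continuousAt_extChartAt_symm x
  have hnhds : e.target ∩ e.symm ⁻¹' U ∈ 𝓝 c :=
    inter_mem (extChartAt_target_mem_nhds (I := 𝓡 n) x)
      (hcont.preimage_mem_nhds (by rw [hex]; exact hU.mem_nhds hx))
  obtain ⟨r, hr, hball⟩ := Metric.mem_nhds_iff.mp hnhds
  set δ := r / (‖w‖ + 1) with hδ
  have hδ0 : 0 < δ := by positivity
  -- The sine keeps the segment bounded for all times while retaining velocity `w` at `0`; the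
  -- choice of `δ` gives `δ * ‖w‖ < r`, so the curve stays in the ball.
  let β : ℝ → EuclideanSpace ℝ (Fin n) := fun t => c + (δ * Real.sin (t / δ)) • w
  have hβ : ContDiff ℝ ∞ β := by
    have h : ContDiff ℝ ∞ (fun t : ℝ => δ * Real.sin (t / δ)) :=
      contDiff_const.mul (Real.contDiff_sin.comp (contDiff_id.div_const δ))
    exact contDiff_const.add (h.smul contDiff_const)
  have hβmem : ∀ t, β t ∈ e.target ∩ e.symm ⁻¹' U := by
    intro t
    apply hball
    rw [Metric.mem_ball, dist_eq_norm]
    simp only [β, add_sub_cancel_left, norm_smul, Real.norm_eq_abs, abs_mul, abs_of_pos hδ0]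
    calc δ * |Real.sin (t / δ)| * ‖w‖ ≤ δ * 1 * ‖w‖ := by
          gcongr; exact Real.abs_sin_le_one _
      _ < δ * (‖w‖ + 1) := by nlinarith
      _ = r := by rw [hδ]; field_simp
  have hβ0 : β 0 = c := by simp [β]
  have hβd : HasDerivAt β w 0 := by
    have h1 : HasDerivAt (fun t : ℝ => δ * Real.sin (t / δ)) 1 0 := by
      have h2 := (((hasDerivAt_id (0 : ℝ)).div_const δ).sin).const_mul δ
      simp only [id, zero_div, Real.cos_zero, one_mul] at h2
      rwa [mul_one_div_cancel hδ0.ne'] at h2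
    have h3 := (h1.smul_const w).const_add c
    rwa [one_smul] at h3
  have hγ : ContMDiff 𝓘(ℝ, ℝ) (𝓡 n) ∞ (fun t => e.symm (β t)) :=
    (contMDiffOn_extChartAt_symm (I := 𝓡 n) x).comp_contMDiff hβ.contMDiff fun t => (hβmem t).1
  have hγ0 : e.symm (β 0) = x := by rw [hβ0, hex]
  refine ⟨fun t => e.symm (β t), hγ, hγ0, fun t => (hβmem t).2, ?_⟩
  have hfd : HasMFDerivAt 𝓘(ℝ, ℝ) (𝓡 n) (fun t => e.symm (β t)) 0
      (ContinuousLinearMap.toSpanSingleton ℝ w : ℝ →L[ℝ] EuclideanSpace ℝ (Fin n)) := by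
    refine ⟨hγ.continuous.continuousAt, ?_⟩
    have h1 : writtenInExtChartAt 𝓘(ℝ, ℝ) (𝓡 n) 0 (fun t => e.symm (β t)) = β := by
      funext t
      simp only [writtenInExtChartAt, hγ0, extChartAt_model_space_eq_id, Function.comp_apply,
        PartialEquiv.refl_symm, PartialEquiv.refl_coe, id]
      exact e.right_inv (hβmem t).1
    rw [h1]
    exact hβd.hasFDerivAt.hasFDerivWithinAt
  have h2 : velocity (fun t => e.symm (β t)) 0 =
      (ContinuousLinearMap.toSpanSingleton ℝ w : ℝ →L[ℝ] EuclideanSpace ℝ (Fin n)) 1 := by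
    rw [velocity, hfd.mfderiv]
    rfl
  rw [h2]
  exact one_smul ℝ w

end Curves

/-! ### Rigidity of transports with finite stabilizers -/

section Uniqueness

variable {n : ℕ} {M : Type*} [TopologicalSpace M] [ChartedSpace (EuclideanSpace ℝ (Fin n)) M]
  [IsManifold (𝓡 n) ∞ M]

theorem IsParallelTransport.continuousAt {nab : AffineConnection n M} {γ : ℝ → M}
    {P : (t : ℝ) → TangentSpace (𝓡 n) (γ 0) →L[ℝ] TangentSpace (𝓡 n) (γ t)}
    (hP : IsParallelTransport nab γ P) (hγ : Continuous γ) (v : TangentSpace (𝓡 n) (γ 0)) :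
    ContinuousAt (fun s => (⟨γ s, P s v⟩ : TangentBundle (𝓡 n) M)) 0 := by
  rw [FiberBundle.continuousAt_totalSpace]
  exact ⟨hγ.continuousAt, (hP.hasDerivAt v).continuousAt⟩

theorem IsLocalDiffeo.continuousAt_tangentMap {φ : OpenPartialHomeomorph M M}
    (hφ : IsLocalDiffeo (n := n) φ) {z : TangentBundle (𝓡 n) M} (hz : z.1 ∈ φ.source) :
    ContinuousAt (tangentMap (𝓡 n) (𝓡 n) φ) z := by
  have h1 := hφ.smooth.continuousOn_tangentMapWithin (by simp) φ.open_source.uniqueMDiffOn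
  have hopen : IsOpen (Bundle.TotalSpace.proj ⁻¹' φ.source : Set (TangentBundle (𝓡 n) M)) :=
    φ.open_source.preimage (FiberBundle.continuous_proj (EuclideanSpace ℝ (Fin n)) _)
  refine (h1.continuousAt (hopen.mem_nhds hz)).congr ?_
  filter_upwards [hopen.mem_nhds hz] with y hy
  rw [tangentMapWithin_eq_tangentMap (φ.open_source.uniqueMDiffOn _ hy)
    (hφ.mdifferentiableAt hy)]

/-- Two families of transports with values in a pseudogroup and preserving corresponding tensors
with finite stabilizers correspond to each other for small times. -/
theorem eventually_transport_comm {Γ : StructureGroupoid M}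
    (hΓ : IsSmoothPseudogroup (n := n) Γ) {φ : OpenPartialHomeomorph M M} (hφ : φ ∈ Γ)
    {k : ℕ} {σ₁ σ₂ : (y : M) → ContraTensor (n := n) k y}
    (hσ : ∀ y ∈ φ.source, pushTensor (mfderiv (𝓡 n) (𝓡 n) φ y) (σ₁ y) = σ₂ (φ y))
    {nab₁ nab₂ : AffineConnection n M} {γ : ℝ → M} (hγ : Continuous γ) (hγφ : ∀ t, γ t ∈ φ.source)
    (hfin : (stabilizer Γ (σ₁ (γ 0))).Finite)
    {P₁ : (t : ℝ) → TangentSpace (𝓡 n) (γ 0) →L[ℝ] TangentSpace (𝓡 n) (γ t)}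
    {P₂ : (t : ℝ) → TangentSpace (𝓡 n) (φ (γ 0)) →L[ℝ] TangentSpace (𝓡 n) (φ (γ t))}
    (hP₁ : IsParallelTransport nab₁ γ P₁) (hP₂ : IsParallelTransport nab₂ (φ ∘ γ) P₂)
    (hj₁ : ∀ t, P₁ t ∈ jets Γ (γ 0) (γ t)) (hj₂ : ∀ t, P₂ t ∈ jets Γ (φ (γ 0)) (φ (γ t)))
    (hs₁ : ∀ t, pushTensor (P₁ t) (σ₁ (γ 0)) = σ₁ (γ t))
    (hs₂ : ∀ t, pushTensor (P₂ t) (σ₂ (φ (γ 0))) = σ₂ (φ (γ t))) :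
    ∀ᶠ s in 𝓝 0, ∀ v, P₂ s (mfderiv (𝓡 n) (𝓡 n) φ (γ 0) v) =
      mfderiv (𝓡 n) (𝓡 n) φ (γ s) (P₁ s v) := by
  -- The discrepancy `S s = (dφ ∘ P₁ s)⁻¹ ∘ P₂ s ∘ dφ` fixes the tensor at `γ 0`, since all four
  -- maps respect `σ₁` and `σ₂`.
  have hS : ∀ s, ∃ S ∈ stabilizer Γ (σ₁ (γ 0)), ∀ v,
      P₂ s (mfderiv (𝓡 n) (𝓡 n) φ (γ 0) v) = mfderiv (𝓡 n) (𝓡 n) φ (γ s) (P₁ s (S v)) := by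
    intro s
    obtain ⟨Q, hQ, hQl, hQr⟩ := exists_inverse_mem_jets hΓ
      (comp_mem_jets hΓ (mfderiv_mem_jets hφ (hγφ s)) (hj₁ s))
    have hN := comp_mem_jets hΓ (hj₂ s) (mfderiv_mem_jets hφ (hγφ 0))
    refine ⟨Q.comp ((P₂ s).comp (mfderiv (𝓡 n) (𝓡 n) φ (γ 0))), ⟨comp_mem_jets hΓ hQ hN, ?_⟩,
      fun v => (hQr _).symm⟩
    rw [pushTensor_comp, pushTensor_comp, hσ _ (hγφ 0), hs₂]
    refine pushTensor_eq_of_leftInverse hQl ?_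
    rw [pushTensor_comp, hs₁, hσ _ (hγφ s)]
  choose S hSmem hSeq using hS
  -- If `τ` moves some `v`, then `dφ (P₁ s (τ v))` and `P₂ s (dφ v)` differ at `s = 0`, hence for
  -- small `s`, by continuity of their coordinates at `0`. As only finitely many `τ` must be
  -- excluded, one neighbourhood of `0` serves for all.
  have hne : ∀ τ ∈ stabilizer Γ (σ₁ (γ 0)), τ ≠ ContinuousLinearMap.id ℝ _ →
      ∀ᶠ s in 𝓝 0, S s ≠ τ := by
    intro τ _ hτ
    obtain ⟨v, hv⟩ : ∃ v, τ v ≠ v := by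
      by_contra! h
      exact hτ (ContinuousLinearMap.ext h)
    have hc₁ : ContinuousAt (fun s => coord (φ (γ 0)) (φ (γ s))
        (mfderiv (𝓡 n) (𝓡 n) φ (γ s) (P₁ s (τ v)))) 0 := by
      have h1 : ContinuousAt (fun s => tangentMap (𝓡 n) (𝓡 n) φ ⟨γ s, P₁ s (τ v)⟩) 0 :=
        ContinuousAt.comp (f := fun s => (⟨γ s, P₁ s (τ v)⟩ : TangentBundle (𝓡 n) M))
          ((hΓ.isLocalDiffeo hφ).continuousAt_tangentMap (hγφ 0)) (hP₁.continuousAt hγ _)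
      rw [FiberBundle.continuousAt_totalSpace] at h1
      exact h1.2
    have hc₂ : ContinuousAt (fun s => coord (φ (γ 0)) (φ (γ s))
        (P₂ s (mfderiv (𝓡 n) (𝓡 n) φ (γ 0) v))) 0 :=
      (hP₂.hasDerivAt (mfderiv (𝓡 n) (𝓡 n) φ (γ 0) v)).continuousAt
    have hne0 : coord (φ (γ 0)) (φ (γ 0)) (mfderiv (𝓡 n) (𝓡 n) φ (γ 0) (P₁ 0 (τ v))) ≠
        coord (φ (γ 0)) (φ (γ 0)) (P₂ 0 (mfderiv (𝓡 n) (𝓡 n) φ (γ 0) v)) := by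
      have hP₂0 : P₂ 0 = ContinuousLinearMap.id ℝ _ := hP₂.1
      rw [hP₁.1, hP₂0]
      intro h
      exact hv ((hΓ.isLocalDiffeo hφ).mfderiv_injective (hγφ 0)
        (((coord_self _ _).symm.trans h).trans (coord_self _ _)))
    filter_upwards [(hc₁.sub hc₂).eventually_ne (sub_ne_zero.mpr hne0)] with s hs hSτ
    exact hs (sub_eq_zero.mpr (by beta_reduce; rw [hSeq s v, hSτ]))
  have hall : ∀ᶠ s in 𝓝 0, ∀ τ ∈ stabilizer Γ (σ₁ (γ 0)), τ ≠ ContinuousLinearMap.id ℝ _ →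
      S s ≠ τ :=
    (hfin.eventually_all).mpr fun τ hτ => by
      by_cases h : τ = ContinuousLinearMap.id ℝ _
      · exact Eventually.of_forall fun _ h' => absurd h h'
      · filter_upwards [hne τ hτ h] with s hs _ using hs
  filter_upwards [hall] with s hs v
  have hid : S s = ContinuousLinearMap.id ℝ _ := by
    by_contra h
    exact hs (S s) (hSmem s) h rfl
  rw [hSeq s v, hid]
  rfl

end Uniqueness

/-! ### Equivalence of operators and of total symbols -/

section Equivalence

variable {n : ℕ} {M : Type*} [TopologicalSpace M] [ChartedSpace (EuclideanSpace ℝ (Fin n)) M]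
  [IsManifold (𝓡 n) ∞ M] [T2Space M] {Γ : StructureGroupoid M} {k : ℕ}
  {A₁ A₂ : Smooth n M →ₗ[ℝ] Smooth n M} {nab₁ nab₂ : AffineConnection n M}
  [nab₁.ContMDiffCovariantDerivative ∞] [nab₂.ContMDiffCovariantDerivative ∞]

/-- Uniqueness of the Wagner connection: an element of `Γ` carrying one principal symbol to the
other carries the Wagner connections to each other. -/
theorem IsWagnerConnection.connRel (hΓ : IsSmoothPseudogroup (n := n) Γ)
    (hW₁ : IsWagnerConnection Γ k A₁ nab₁) (hW₂ : IsWagnerConnection Γ k A₂ nab₂)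
    (hfin : ∀ a : M, (stabilizer Γ (principalSymbol k A₁ a)).Finite)
    {φ : OpenPartialHomeomorph M M} (hφ : φ ∈ Γ)
    (hσ : ∀ y ∈ φ.source, pushTensor (mfderiv (𝓡 n) (𝓡 n) φ y) (principalSymbol k A₁ y) =
      principalSymbol k A₂ (φ y)) {x : M} (hx : x ∈ φ.source) : ConnRel φ x nab₁ nab₂ := by
  have hφd := hΓ.isLocalDiffeo hφ
  filter_upwards [φ.open_source.mem_nhds hx] with y hy Y Y' hYY' w
  obtain ⟨γ, hγ, rfl, hγφ, hγw⟩ := exists_curve φ.open_source hy w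
  replace hγw : velocity γ 0 = w := hγw
  have hγ' : ContMDiff 𝓘(ℝ, ℝ) (𝓡 n) ∞ (φ ∘ γ) := hφd.smooth.comp_contMDiff hγ hγφ
  obtain ⟨P₁, hP₁, hj₁⟩ := hW₁.isGamma γ hγ
  obtain ⟨P₂, hP₂, hj₂⟩ := hW₂.isGamma (φ ∘ γ) hγ'
  have hcomm := eventually_transport_comm hΓ hφ hσ hγ.continuous hγφ (hfin (γ 0)) hP₁ hP₂ hj₁ hj₂
    (hW₁.preserves γ hγ P₁ hP₁) (hW₂.preserves (φ ∘ γ) hγ' P₂ hP₂)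
  -- `Q s` undoes the transport along `γ`. By `hcomm`, `dφ` takes `Y` moved back along `γ` to `Y'`
  -- moved back along `φ ∘ γ`; differentiating both at `0` compares the covariant derivatives.
  choose Q _ _ hQ using fun s => exists_inverse_mem_jets hΓ (hj₁ s)
  have hd₁ := hP₁.hasDerivAt_of_apply_eq (hγ.mdifferentiableAt (by simp)) Y.mdifferentiableAt
    (u := fun s => Q s (Y (γ s))) (Eventually.of_forall fun s => hQ s _)
  have hd₂ := hP₂.hasDerivAt_of_apply_eq (hγ'.mdifferentiableAt (by simp)) Y'.mdifferentiableAt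
    (u := fun s => mfderiv (𝓡 n) (𝓡 n) φ (γ 0) (Q s (Y (γ s)))) (by
      filter_upwards [hcomm, hγ.continuous.continuousAt.eventually hYY'] with s hs hYs
      exact (hs _).trans ((congrArg (mfderiv (𝓡 n) (𝓡 n) φ (γ s)) (hQ s _)).trans hYs))
  have hvel : velocity (φ ∘ γ) 0 = mfderiv (𝓡 n) (𝓡 n) φ (γ 0) (velocity γ 0) :=
    DFunLike.congr_fun (mfderiv_comp (0 : ℝ) (hφd.mdifferentiableAt (hγφ 0))
      (hγ.mdifferentiableAt (x := 0) (by simp))) (1 : ℝ)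
  let D : EuclideanSpace ℝ (Fin n) →L[ℝ] EuclideanSpace ℝ (Fin n) :=
    mfderiv (𝓡 n) (𝓡 n) φ (γ 0)
  have hd₃ := D.hasFDerivAt.comp_hasDerivAt (0 : ℝ) hd₁
  have h := hd₃.unique hd₂
  rw [hvel, hγw] at h
  exact h

theorem totalSymbol_self (nab : AffineConnection n M) [nab.ContMDiffCovariantDerivative ∞]
    (A : Smooth n M →ₗ[ℝ] Smooth n M) (x : M) :
    totalSymbol nab k A (Fin.last k) x = principalSymbol k A x := by
  simp only [totalSymbol, Fin.val_last, Nat.sub_self]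
  rfl

/-- Corresponding operators have corresponding remainders. -/
theorem remainder_natural {φ : OpenPartialHomeomorph M M} (hφ : IsLocalDiffeo (n := n) φ)
    (hA₁ : IsDiffOp k A₁) {x : M} (hx : x ∈ φ.source) (hn : ConnRel φ x nab₁ nab₂)
    (hA : ∀ g f : Smooth n M, FnRel φ x g f → A₁ g x = A₂ f (φ x)) {r : ℕ} (hr : r ≤ k + 1)
    {g f : Smooth n M} (hgf : FnRel φ x g f) :
    remainder nab₁ k A₁ r g x = remainder nab₂ k A₂ r f (φ x) := by
  induction r generalizing g f with
  | zero => exact hA g f hgf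
  | succ r ih =>
    have h1 := ih (by omega) hgf
    have h2 := quantize_natural hφ hx hn (H₁ := smbl (k - r) (remainder nab₁ k A₁ r))
      (H₂ := smbl (k - r) (remainder nab₂ k A₂ r))
      (smbl_natural hφ hx (remainder_killsAt nab₁ hA₁ x (by omega)) fun g f => ih (by omega)) hgf
    exact congrArg₂ (· - ·) h1 h2

/-- If the components of the total symbols correspond, then so do the remainders. -/
theorem remainder_natural_of_symbols {φ : OpenPartialHomeomorph M M}
    (hφ : IsLocalDiffeo (n := n) φ) (hA₁ : IsDiffOp k A₁) (hA₂ : IsDiffOp k A₂) {x : M}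
    (hx : x ∈ φ.source) (hn : ConnRel φ x nab₁ nab₂)
    (hσ : ∀ j : Fin (k + 1), pushTensor (mfderiv (𝓡 n) (𝓡 n) φ x) (totalSymbol nab₁ k A₁ j x) =
      totalSymbol nab₂ k A₂ j (φ x)) {r j : ℕ} (hrj : r + j = k + 1)
    {g f : Smooth n M} (hgf : FnRel φ x g f) :
    remainder nab₁ k A₁ r g x = remainder nab₂ k A₂ r f (φ x) := by
  -- Descending induction on `r`: it starts from the vanishing remainder at `r = k + 1`, and each
  -- step adds back the quantization of the symbol of degree `j`.
  induction j generalizing r with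
  | zero =>
    obtain rfl : r = k + 1 := by omega
    rw [remainder_succ_self nab₁ hA₁, remainder_succ_self nab₂ hA₂]
    rfl
  | succ j ih =>
    have h1 := ih (r := r + 1) (by omega)
    obtain rfl : r = k - j := by omega
    have hj : k - (k - j) = j := by omega
    have hσj := hσ ⟨j, by omega⟩
    have h2 := quantize_natural hφ hx hn (H₁ := smbl j (remainder nab₁ k A₁ (k - j)))
      (H₂ := smbl j (remainder nab₂ k A₂ (k - j))) hσj hgf
    have h3 : ∀ (nab : AffineConnection n M) [nab.ContMDiffCovariantDerivative ∞]
        (A : Smooth n M →ₗ[ℝ] Smooth n M), remainder nab k A (k - j) =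
          remainder nab k A (k - j + 1) + quantize nab (smbl j (remainder nab k A (k - j))) := by
      intro nab _ A
      change _ = (remainder nab k A (k - j) -
        quantize nab (smbl (k - (k - j)) (remainder nab k A (k - j)))) + _
      rw [hj, sub_add_cancel]
    rw [h3 nab₁ A₁, h3 nab₂ A₂]
    exact congrArg₂ (· + ·) h1 h2

end Equivalence

end GammaOp
end

/-! ### The equivalence theorem -/

theorem mainTheorem4 {n : ℕ} {M : Type*} [TopologicalSpace M] [T2Space M]
    [SecondCountableTopology M] [ConnectedSpace M] [ChartedSpace (EuclideanSpace ℝ (Fin n)) M]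
    [IsManifold (𝓡 n) ∞ M]
    (Γ : StructureGroupoid M) (hΓ : GammaOp.IsSmoothPseudogroup (n := n) Γ)
    (hΓt : GammaOp.IsTransitive Γ)
    (k : ℕ) (A₁ A₂ : GammaOp.Smooth n M →ₗ[ℝ] GammaOp.Smooth n M)
    (hA₁ : GammaOp.IsDiffOp k A₁) (hA₂ : GammaOp.IsDiffOp k A₂)
    (hc₁ : GammaOp.HasConstantType Γ (GammaOp.principalSymbol k A₁))
    (hc₂ : GammaOp.HasConstantType Γ (GammaOp.principalSymbol k A₂))
    (hs₁ : ∀ a : M, (GammaOp.stabilizer Γ (GammaOp.principalSymbol k A₁ a)).Finite)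
    (hs₂ : ∀ a : M, (GammaOp.stabilizer Γ (GammaOp.principalSymbol k A₂ a)).Finite)
    (nab₁ nab₂ : GammaOp.AffineConnection n M)
    [nab₁.ContMDiffCovariantDerivative ∞] [nab₂.ContMDiffCovariantDerivative ∞]
    (hW₁ : GammaOp.IsWagnerConnection Γ k A₁ nab₁)
    (hW₂ : GammaOp.IsWagnerConnection Γ k A₂ nab₂)
    (U V : Set M) (hU : IsOpen U) (hV : IsOpen V) :
    GammaOp.OperatorsEquivalent Γ A₁ A₂ U V ↔
      GammaOp.SymbolsEquivalent Γ (GammaOp.totalSymbol nab₁ k A₁) (GammaOp.totalSymbol nab₂ k A₂)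
        U V := by
  constructor
  · rintro ⟨φ, hφ, rfl, hφV, hA⟩
    have hφd := hΓ.isLocalDiffeo hφ
    -- The principal symbol does not involve a connection, so it corresponds before anything is
    -- known about `nab₁` and `nab₂`.
    have hσ : ∀ y ∈ φ.source, GammaOp.pushTensor (mfderiv (𝓡 n) (𝓡 n) φ y)
        (GammaOp.principalSymbol k A₁ y) = GammaOp.principalSymbol k A₂ (φ y) := fun y hy =>
      GammaOp.smbl_natural hφd hy (fun f hf => hA₁.apply_eq_zero hf)
        fun g f hgf => hA y hy f g hgf
    refine ⟨φ, hφ, rfl, hφV, fun x hx j => ?_⟩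
    have hn := hW₁.connRel hΓ hW₂ hs₁ hφ hσ hx
    exact GammaOp.smbl_natural hφd hx (GammaOp.remainder_killsAt nab₁ hA₁ x (by omega))
      fun g f hgf => GammaOp.remainder_natural hφd hA₁ hx hn
        (fun g f hgf => hA x hx f g hgf) (by omega) hgf
  · rintro ⟨φ, hφ, rfl, hφV, hσ⟩
    have hφd := hΓ.isLocalDiffeo hφ
    refine ⟨φ, hφ, rfl, hφV, fun x hx f g hgf => ?_⟩
    -- The top component of the total symbol is the principal symbol, which determines the Wagner
    -- connection.
    have hn := hW₁.connRel hΓ hW₂ hs₁ hφ (fun y hy => by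
      have h := hσ y hy (Fin.last k)
      rwa [GammaOp.totalSymbol_self, GammaOp.totalSymbol_self] at h) hx
    exact GammaOp.remainder_natural_of_symbols hφd hA₁ hA₂ hx hn (hσ x hx) (r := 0)
      (zero_add _) hgf
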